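/- Let $\Omega\subset\mathbb R^2$ be open, $\mathrm{Re}>0$, $T>0$. Let $\mathring{\mathcal V}=H^1_0(\Omega)^2$ (the closure of $C_c^\infty(\Omega)^2$ in the norm $\|v\|_{\mathring{\mathcal V}}^2=\|v\|_{L^2}^2+\|\nabla v\|_{L^2}^2$) and $\mathcal P=\{q\in L^2(\Omega):\int_\Omega q=0\}$. Put $$a_k(u,v)=k\int_\Omega u\cdot v,\qquad b(v,q)=-\int_\Omega q\,\nabla\cdot v,\qquad \mathrm L_u(v)=-\frac1{\mathrm{Re}}\int_\Omega\nabla u:\nabla v .$$ *Exact solution.* Let $(u,p)$ be a weak solution on $[0,T]$ of the unsteady Stokes problem $\partial_t u+\nabla p=\frac1{\mathrm{Re}}\Delta u$, $\nabla\cdot u=0$ with homogeneous Dirichlet data and initial velocity $u(0)=u_0\in\mathring{\mathcal V}$, that is, $u\in L^2(0,T;\mathring{\mathcal V})$ with $u(t)\in\mathring{\mathcal V}$ for every $t\in[0,T]$, $p\in L^2(0,T;\mathcal P)$, and for every $t\in[0,T]$ $$a_1(u(t)-u_0,v)+\int_0^t b(v,p(\tau))\,d\tau=\int_0^t \mathrm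 L_{u(\tau)}(v)\,d\tau\quad\forall v\in\mathring{\mathcal V},\qquad b(u(t),q)=0\quad\forall q\in\mathcal P .$$ *Discretization.* Let $(\mathcal T_h)$ be a family of conforming triangulations of $\overline\Omega$ (finitely many triangles), where the mesh size $h$ is the largest radius of the circles inscribed in the triangles. Assume the family is shape-regular: there is $\sigma$ such that every triangle $K$ of every $\mathcal T_h$ has $\operatorname{diam}K\le\sigma\rho_K$, with $\rho_K$ the radius of its inscribed circle. Let $r<s$ be integers $\ge 0$, let $\mathcal V_h^s\subset\mathring{\mathcal V}$ be the subspace of fields that are continuous on $\overline\Omega$ and polynomial of degree at most $s$ on each triangle, and let $\mathcal P_h^r\subset\mathcal P$ be the subspace of functions that are continuous on $\overline\Omega$ and polynomial of degree at most $r$ on each triangle. Let $u_{0,h}\in\mathcal V_h^s$ be approximations of $u_0$ with $\|u_0-u_{0,h}\|_{\mathring{\mathcal V}}\le C\inf_{w\in\mathcal V_h^s}\|u_0-w\|_{\mathring{\mathcal V}}$, with $C$ independent of $h$ (for example $C=1$ and $u_{0,h}$ the orthogonal projection of $u_0$), and let $(u_{k+1,h},p_{k,h})\in\mathcal V_h^s\times\mathcal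 P_h^r$, $k=0,1,2,\dots$, be computed recursively as solutions of the mixed problems $$a_{k+1}(u_{k+1,h},v_h)+b(v_h,p_{k,h})=\mathrm L_{u_{k,h}}(v_h)\quad\forall v_h\in\mathcal V_h^s,\qquad b(u_{k+1,h},q_h)=0\quad\forall q_h\in\mathcal P_h^r .$$ For $m\ge0$ and $0<\Delta t\le T$ let $$e_m(\Delta t,h)=\Big\|u(\Delta t)-\sum_{k=0}^m u_{k,h}\,\Delta t^k\Big\|_{\mathring{\mathcal V}} .$$ *Claim.* For each fixed $m$, the limit $\lim_{\Delta t\to0^+}e_m(\Delta t,h)$ exists for every mesh of the family, and $$\lim_{h\to0}\ \lim_{\Delta t\to0^+}e_m(\Delta t,h)=0 .$$ -/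

import Mathlib

open MeasureTheory Filter Topology Set
open scoped ContDiff

noncomputable section

namespace TSEFEM

/-! ### Function spaces on a planar open set -/

/-- Points of the plane (and values of velocity fields). -/
abbrev Plane : Type := EuclideanSpace ℝ (Fin 2)

/-- `2 × 2` matrices with the Frobenius inner product; the entry `(i, j)` of a velocity gradient is
`∂ⱼ vᵢ`. -/
abbrev Mat : Type := EuclideanSpace ℝ (Fin 2 × Fin 2)

/-- Lebesgue measure on `Ω`. -/
abbrev vol (Ω : Set Plane) : Measure Plane := volume.restrict Ω

/-- The Hilbert space `L²(Ω)² × L²(Ω)^{2×2}` of pairs (field, gradient), with norm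
`(‖v‖² + ‖G‖²)^{1/2}`. -/
abbrev L2Pair (Ω : Set Plane) : Type :=
  WithLp 2 (Lp Plane 2 (vol Ω) × Lp Mat 2 (vol Ω))

/-- The pair `(φ, ∇φ)` of a smooth field `φ` with compact support in `Ω`. -/
def IsTestPair (Ω : Set Plane) (z : L2Pair Ω) : Prop :=
  ∃ φ : Plane → Plane, ContDiff ℝ ∞ φ ∧ HasCompactSupport φ ∧ tsupport φ ⊆ Ω ∧
    (⇑z.fst =ᵐ[vol Ω] φ) ∧
    ∀ i j : Fin 2, (fun x => z.snd x (i, j)) =ᵐ[vol Ω]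
      fun x => fderiv ℝ φ x (EuclideanSpace.single j 1) i

/-- The velocity space `H¹₀(Ω)²`: the closure of the smooth compactly supported fields for the
`H¹` norm. An element is the pair (field, weak gradient), and its norm is the full `H¹` norm
`(‖v‖²_{L²} + ‖∇v‖²_{L²})^{1/2}`. -/
def velocitySubmodule (Ω : Set Plane) : Submodule ℝ (L2Pair Ω) :=
  (Submodule.span ℝ {z | IsTestPair Ω z}).topologicalClosure

/-- `H¹₀(Ω)²` as a normed space. -/
abbrev Velocity (Ω : Set Plane) : Type := velocitySubmodule Ω

/-- The field itself. -/
def Velocity.field {Ω : Set Plane} (v : Velocity Ω) : Plane → Plane := ⇑(v : L2Pair Ω).fst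

/-- Its weak gradient. -/
def Velocity.grad {Ω : Set Plane} (v : Velocity Ω) : Plane → Mat := ⇑(v : L2Pair Ω).snd

/-- Its weak divergence. -/
def Velocity.div {Ω : Set Plane} (v : Velocity Ω) (x : Plane) : ℝ :=
  v.grad x (0, 0) + v.grad x (1, 1)

/-- The pressure space: square integrable functions on `Ω` of zero mean. -/
def pressureSubmodule (Ω : Set Plane) : Submodule ℝ (Lp ℝ 2 (vol Ω)) where
  carrier := {q | Integrable q (vol Ω) ∧ ∫ x in Ω, q x = 0}
  zero_mem' := by
    have h := Lp.coeFn_zero ℝ 2 (vol Ω)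
    refine ⟨(integrable_zero _ _ _).congr h.symm, ?_⟩
    rw [integral_congr_ae h]; simp
  add_mem' := by
    rintro p q ⟨hp, hp0⟩ ⟨hq, hq0⟩
    have h := Lp.coeFn_add p q
    refine ⟨(hp.add hq).congr h.symm, ?_⟩
    rw [integral_congr_ae h]
    simp only [Pi.add_apply]
    rw [integral_add hp hq, hp0, hq0, add_zero]
  smul_mem' := by
    rintro c q ⟨hq, hq0⟩
    have h := Lp.coeFn_smul c q
    refine ⟨(hq.smul c).congr h.symm, ?_⟩
    rw [integral_congr_ae h]
    simp only [Pi.smul_apply]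
    rw [integral_smul, hq0, smul_zero]

/-- `L²₀(Ω)` as a normed space. -/
abbrev Pressure (Ω : Set Plane) : Type := pressureSubmodule Ω

/-! ### The forms of the mixed formulation -/

/-- `a_k(u, v) = k ∫ u · v`. -/
def aForm {Ω : Set Plane} (k : ℕ) (u v : Velocity Ω) : ℝ :=
  k * ∫ x in Ω, inner ℝ (u.field x) (v.field x)

/-- `b(v, q) = -∫ q div v`. -/
def bForm {Ω : Set Plane} (v : Velocity Ω) (q : Pressure Ω) : ℝ :=
  -∫ x in Ω, (q : Lp ℝ 2 (vol Ω)) x * v.div x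

/-- `L_u(v) = -(1/Re) ∫ ∇u : ∇v`, the weak form of `(1/Re) Δu`. -/
def lForm {Ω : Set Plane} (Re : ℝ) (u v : Velocity Ω) : ℝ :=
  -(1 / Re) * ∫ x in Ω, inner ℝ (u.grad x) (v.grad x)

/-! ### The unsteady Stokes problem -/

/-- `(u, p)` is a weak solution on `[0, T]` of `∂ₜu + ∇p = (1/Re) Δu`, `div u = 0` in `Ω`, `u = 0` on
the boundary, with initial value `u 0`: `u ∈ L²(0,T; H¹₀)`, `p ∈ L²(0,T; L²₀)`, and the mixed
variational formulation holds, integrated in time from `0` to `t`, for every `t ∈ [0, T]`. -/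
structure IsStokesSolution {Ω : Set Plane} (Re T : ℝ) (u : ℝ → Velocity Ω) (p : ℝ → Pressure Ω) :
    Prop where
  memLp_velocity : MemLp u 2 (volume.restrict (Ioc 0 T))
  memLp_pressure : MemLp p 2 (volume.restrict (Ioc 0 T))
  momentum : ∀ t ∈ Icc 0 T, ∀ v : Velocity Ω,
    aForm 1 (u t - u 0) v + ∫ τ in (0 : ℝ)..t, bForm v (p τ) = ∫ τ in (0 : ℝ)..t, lForm Re (u τ) v
  divergence_free : ∀ t ∈ Icc 0 T, ∀ q : Pressure Ω, bForm (u t) q = 0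

/-! ### Triangulations -/

/-- A (conforming) triangulation of `Ω`: a finite simplicial complex that covers the closure of `Ω`,
all of whose faces are faces of its triangles. -/
structure Triangulation (Ω : Set Plane) extends Geometry.SimplicialComplex ℝ Plane where
  finite_faces : faces.Finite
  exists_triangle : ∀ e ∈ faces, ∃ K ∈ faces, e ⊆ K ∧ K.card = 3
  space_eq : toSimplicialComplex.space = closure Ω

/-- The triangles, each given by its set of vertices. -/
def Triangulation.cells {Ω : Set Plane} (𝒯 : Triangulation Ω) : Set (Finset Plane) :=
  {K | K ∈ 𝒯.faces ∧ K.card = 3}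

/-- The closed triangle with vertex set `K`. -/
def triangle (K : Finset Plane) : Set Plane := convexHull ℝ (K : Set Plane)

/-- Radius of the largest disc contained in a triangle. -/
def inradius (K : Finset Plane) : ℝ :=
  sSup {ρ : ℝ | 0 ≤ ρ ∧ ∃ c : Plane, Metric.closedBall c ρ ⊆ triangle K}

/-- The mesh size: the largest radius of the circles inscribed in the triangles of the mesh. -/
def Triangulation.meshSize {Ω : Set Plane} (𝒯 : Triangulation Ω) : ℝ :=
  sSup (inradius '' 𝒯.cells)

/-- Shape regularity with constant `σ`: the diameter of each triangle is at most `σ` times the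
radius of its inscribed circle. -/
def Triangulation.ShapeRegular {Ω : Set Plane} (𝒯 : Triangulation Ω) (σ : ℝ) : Prop :=
  ∀ K ∈ 𝒯.cells, Metric.diam (triangle K) ≤ σ * inradius K

/-! ### Finite element spaces and the scheme -/

/-- Continuous functions on the closure of `Ω` that are polynomials of degree at most `d` on each
triangle. -/
def Triangulation.IsPiecewisePoly {Ω : Set Plane} (𝒯 : Triangulation Ω) (d : ℕ) (w : Plane → ℝ) :
    Prop :=
  ContinuousOn w (closure Ω) ∧ ∀ K ∈ 𝒯.cells, ∃ P : MvPolynomial (Fin 2) ℝ,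
    P.totalDegree ≤ d ∧ ∀ x ∈ triangle K, w x = MvPolynomial.eval (fun i => x i) P

/-- `V_h^s`: the fields of `H¹₀(Ω)²` that are continuous and piecewise polynomial of degree `s`. -/
def Triangulation.velocityFE {Ω : Set Plane} (𝒯 : Triangulation Ω) (s : ℕ) : Set (Velocity Ω) :=
  {v | ∀ i : Fin 2, ∃ w : Plane → ℝ, 𝒯.IsPiecewisePoly s w ∧
    (fun x => v.field x i) =ᵐ[vol Ω] w}

/-- `P_h^r`: the zero mean functions that are continuous and piecewise polynomial of degree `r`. -/
def Triangulation.pressureFE {Ω : Set Plane} (𝒯 : Triangulation Ω) (r : ℕ) : Set (Pressure Ω) :=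
  {q | ∃ w : Plane → ℝ, 𝒯.IsPiecewisePoly r w ∧ (⇑(q : Lp ℝ 2 (vol Ω)) =ᵐ[vol Ω] w)}

/-- The discrete modes: `u_{0,h} ∈ V_h^s`, and for each `k` the pair `(u_{k+1,h}, p_{k,h})` solves the
discrete mixed problem whose right-hand side is computed from `u_{k,h}`. -/
structure IsDiscreteModes {Ω : Set Plane} (𝒯 : Triangulation Ω) (s r : ℕ) (Re : ℝ)
    (uh : ℕ → Velocity Ω) (ph : ℕ → Pressure Ω) : Prop where
  velocity_mem : ∀ k, uh k ∈ 𝒯.velocityFE s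
  pressure_mem : ∀ k, ph k ∈ 𝒯.pressureFE r
  momentum : ∀ k, ∀ v ∈ 𝒯.velocityFE s,
    aForm (k + 1) (uh (k + 1)) v + bForm v (ph k) = lForm Re (uh k) v
  divergence_free : ∀ k, ∀ q ∈ 𝒯.pressureFE r, bForm (uh (k + 1)) q = 0

/-- The error `e_m(Δt, h)`: the `H¹₀` norm of `u(Δt) - ∑_{k ≤ m} Δt^k u_{k,h}`. -/
def truncationError {Ω : Set Plane} (u : ℝ → Velocity Ω) (uh : ℕ → Velocity Ω) (m : ℕ) (dt : ℝ) :
    ℝ :=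
  ‖u dt - ∑ k ∈ Finset.range (m + 1), dt ^ k • uh k‖

end TSEFEM

end

/-!
The limit as `Δt → 0⁺` of the truncation error is `‖u(0) - u_{0,h}‖`, so two facts are needed.

*Continuity of the weak solution at the initial time in the `H¹` norm*
(`IsStokesSolution.tendsto_initial`). Tested with divergence free fields the pressure drops out. Let
`J` be the embedding of `H¹₀` into `L²` and `B = J* J`, for the `H¹` inner product restricted to
divergence free fields. The equation becomes `B u(t) = B u(0) - ν (1 - B) ∫₀ᵗ u` with `ν = 1 / Re`
and `0 ≤ B ≤ 1`. Applying `B` once more makes `B² u` continuously differentiable, and `‖B² u‖` is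
nonincreasing. The same holds for `K u` with any bounded `K` commuting with `B`. With `K = (B +
ε)⁻²` and `ε → 0` this gives `‖u(t)‖ ≤ ‖u(0)‖` for every `t` (`norm_le_of_evolution`), because `B`
is injective: a field of `H¹₀` that vanishes has vanishing weak gradient (`fieldL_injective`). Since
`B u(t) → B u(0)`, also `u(t) ⇀ u(0)` weakly, and the bound on the norms upgrades this to strong
convergence (`tendsto_of_evolution`).

*Density of the finite element spaces* (`eventually_exists_velocityFE`). A test field is
approximated by its continuous piecewise affine nodal interpolant. On a triangle the interpolant
differs from a Taylor polynomial by an affine map that is `O(diam²)`, and an inscribed disc of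
radius comparable to the diameter bounds the derivative of such a map by `O(diam)`
(`interpolation_error`). On a fine mesh the interpolant is Lipschitz with compact support in `Ω`
(`Triangulation.exists_nodal_interpolant`), and mollification shows that such fields belong to
`H¹₀`, with the almost everywhere derivative as weak gradient (`exists_velocity_of_lipschitz`). The
assumption on `u_{0,h}` then gives `‖u(0) - u_{0,h}‖ → 0`.
-/

namespace TSEFEM

/-! ### Contractivity and continuity at the initial time of a self-adjoint evolution -/

section Evolution

variable {H : Type*} [NormedAddCommGroup H] [InnerProductSpace ℝ H] [CompleteSpace H]

/-- If `‖B x‖² ≤ ⟪B x, x⟫` (for symmetric `B` this means `0 ≤ B ≤ 1`) and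
`B u(t) = B u(0) - ν (1 - B) ∫₀ᵗ u`, then `B² u` is continuous, differentiable inside the interval,
and its norm is nonincreasing: the derivative of `‖B² u‖²` is `-2 ν ⟪B (B u), (1 - B) (B u)⟫ ≤ 0`.
The function `u` itself is only assumed integrable. -/
lemma norm_sq_apply_le_of_evolution {B : H →L[ℝ] H}
    (hB : ∀ x, ‖B x‖ ^ 2 ≤ inner ℝ (B x) x) {ν T : ℝ} (hν : 0 ≤ ν) {u : ℝ → H}
    (hu : IntegrableOn u (Icc 0 T))
    (h : ∀ t ∈ Icc 0 T, B (u t) = B (u 0) -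
      ν • ((∫ τ in (0 : ℝ)..t, u τ) - B (∫ τ in (0 : ℝ)..t, u τ)))
    {t : ℝ} (ht : t ∈ Icc 0 T) : ‖B (B (u t))‖ ≤ ‖B (B (u 0))‖ := by
  have hT : 0 ≤ T := ht.1.trans ht.2
  have hprim : ContinuousOn (fun t => ∫ τ in (0 : ℝ)..t, u τ) (Icc 0 T) := by
    have := intervalIntegral.continuousOn_primitive_interval (a := 0) (b := T) (f := u)
      (μ := volume) (by rwa [uIcc_of_le hT])
    rwa [uIcc_of_le hT] at this
  have hw : ContinuousOn (fun t => B (u t)) (Icc 0 T) := by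
    refine ContinuousOn.congr ?_ h
    exact continuousOn_const.sub ((hprim.sub (B.continuous.comp_continuousOn hprim)).const_smul ν)
  have hint : ∀ t ∈ Icc 0 T, IntervalIntegrable u volume 0 t := fun t ht =>
    (intervalIntegrable_iff_integrableOn_Icc_of_le ht.1).2
      (hu.mono_set (Icc_subset_Icc_right ht.2))
  -- the equation for `B u`, whose integrand is now continuous
  have hz : ∀ t ∈ Icc 0 T, B (B (u t)) = B (B (u 0)) -
      ν • ((∫ τ in (0 : ℝ)..t, B (u τ)) - B (∫ τ in (0 : ℝ)..t, B (u τ))) := by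
    intro t ht
    rw [B.intervalIntegral_comp_comm (hint t ht), h t ht]
    simp
  have hderiv : ∀ t ∈ Ioo 0 T,
      HasDerivAt (fun t => B (B (u t))) (-(ν • (B (u t) - B (B (u t))))) t := by
    intro t ht
    have ht' := Ioo_subset_Icc_self ht
    have hI : HasDerivAt (fun t => ∫ τ in (0 : ℝ)..t, B (u τ)) (B (u t)) t := by
      refine intervalIntegral.integral_hasDerivAt_right ?_ ?_ ?_
      · exact (hw.mono (by
          rw [uIcc_of_le ht'.1]; exact Icc_subset_Icc_right ht'.2)).intervalIntegrable
      · exact ContinuousOn.stronglyMeasurableAtFilter isOpen_Ioo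
          (hw.mono Ioo_subset_Icc_self) t ht
      · exact hw.continuousAt (Icc_mem_nhds ht.1 ht.2)
    have h1 := ((hI.sub (B.hasFDerivAt.comp_hasDerivAt t hI)).const_smul ν).const_sub (B (B (u 0)))
    refine h1.congr_of_eventuallyEq ?_
    filter_upwards [Icc_mem_nhds ht.1 ht.2] with x hx
    exact hz x hx
  have hanti : AntitoneOn (fun t => ‖B (B (u t))‖ ^ 2) (Icc 0 T) := by
    have hd : ∀ t ∈ Ioo 0 T, HasDerivAt (fun t => ‖B (B (u t))‖ ^ 2)
        (2 * inner ℝ (B (B (u t))) (-(ν • (B (u t) - B (B (u t)))))) t :=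
      fun t ht => (hderiv t ht).norm_sq
    refine antitoneOn_of_deriv_nonpos (convex_Icc _ _) ?_ ?_ ?_
    · exact (B.continuous.comp_continuousOn hw).norm.pow 2
    · rw [interior_Icc]
      exact fun t ht => (hd t ht).differentiableAt.differentiableWithinAt
    · rw [interior_Icc]
      intro t ht
      rw [(hd t ht).deriv, inner_neg_right, inner_smul_right, inner_sub_right,
        real_inner_self_eq_norm_sq]
      nlinarith [mul_nonneg hν (sub_nonneg.2 (hB (B (u t))))]
  exact (sq_le_sq₀ (norm_nonneg _) (norm_nonneg _)).1 (hanti ⟨le_rfl, hT⟩ ht ht.1)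

/-- The resolvent `R = (B + ε)⁻¹` of a positive operator `B`: both `B R` and `ε R = 1 - B R` are
contractions. -/
lemma exists_resolvent {B : H →L[ℝ] H} (hB : ∀ x, ‖B x‖ ^ 2 ≤ inner ℝ (B x) x) {ε : ℝ}
    (hε : 0 < ε) :
    ∃ R : H →L[ℝ] H, (∀ x, B (R x) + ε • R x = x) ∧ (∀ x, R (B x) = B (R x)) ∧
      (∀ x, ‖B (R x)‖ ≤ ‖x‖) ∧ ∀ x, ‖ε • R x‖ ≤ ‖x‖ := by
  have hpos : ∀ x, 0 ≤ inner ℝ (B x) x := fun x => (sq_nonneg _).trans (hB x)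
  have hunit : IsUnit (B + ε • ContinuousLinearMap.id ℝ H) := by
    refine ContinuousLinearMap.isUnit_of_forall_le_norm_inner_map _ (c := ⟨ε, hε.le⟩) hε fun x => ?_
    refine le_trans ?_ (le_abs_self _)
    simp only [add_apply, smul_apply, ContinuousLinearMap.id_apply, inner_add_left, inner_smul_left,
      real_inner_self_eq_norm_sq]
    have := hpos x
    simp only [conj_trivial]
    change ‖x‖ ^ 2 * ε ≤ _
    linarith
  obtain ⟨U, hU⟩ := hunit
  have h1 : ∀ x, B ((↑U⁻¹ : H →L[ℝ] H) x) + ε • (↑U⁻¹ : H →L[ℝ] H) x = x := by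
    intro x
    have := congrArg (fun f : H →L[ℝ] H => f x) U.mul_inv
    simpa [hU] using this
  have h2 : ∀ x, (↑U⁻¹ : H →L[ℝ] H) (B x) + ε • (↑U⁻¹ : H →L[ℝ] H) x = x := by
    intro x
    have := congrArg (fun f : H →L[ℝ] H => f x) U.inv_mul
    simpa [hU] using this
  have h3 : ∀ y, ‖B y + ε • y‖ ^ 2 = ‖B y‖ ^ 2 + 2 * (ε * inner ℝ (B y) y) + ‖ε • y‖ ^ 2 :=
    fun y => by rw [norm_add_sq_real, inner_smul_right]
  refine ⟨(↑U⁻¹ : H →L[ℝ] H), h1, fun x => ?_, fun x => ?_, fun x => ?_⟩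
  · exact add_right_cancel ((h2 x).trans (h1 x).symm)
  all_goals
    set y := (↑U⁻¹ : H →L[ℝ] H) x
    have hx : x = B y + ε • y := (h1 x).symm
    rw [← sq_le_sq₀ (norm_nonneg _) (norm_nonneg _), hx, h3]
    nlinarith [mul_nonneg hε.le (hpos y), sq_nonneg ‖ε • y‖, sq_nonneg ‖B y‖]

/-- Contractivity of the evolution `B u(t) = B u(0) - ν (1 - B) ∫₀ᵗ u`. The operators
`(B (B + ε)⁻¹)²` commute with `B`, are contractions, and tend strongly to the identity because `B`
has dense range; each of them reduces the claim to
`norm_sq_apply_le_of_evolution`. -/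
lemma norm_le_of_evolution {B : H →L[ℝ] H} (hB : ∀ x, ‖B x‖ ^ 2 ≤ inner ℝ (B x) x)
    (hdense : DenseRange B) {ν T : ℝ} (hν : 0 ≤ ν) {u : ℝ → H} (hu : IntegrableOn u (Icc 0 T))
    (h : ∀ t ∈ Icc 0 T, B (u t) = B (u 0) -
      ν • ((∫ τ in (0 : ℝ)..t, u τ) - B (∫ τ in (0 : ℝ)..t, u τ)))
    {t : ℝ} (ht : t ∈ Icc 0 T) : ‖u t‖ ≤ ‖u 0‖ := by
  refine le_of_forall_pos_le_add fun δ hδ => ?_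
  obtain ⟨y, hy⟩ := hdense.exists_dist_lt (u t) (show 0 < δ / 4 by positivity)
  obtain ⟨ε, hε, hεy⟩ : ∃ ε : ℝ, 0 < ε ∧ ε * ‖y‖ ≤ δ / 4 := by
    refine ⟨δ / 4 / (‖y‖ + 1), by positivity, ?_⟩
    rw [div_mul_eq_mul_div, div_le_iff₀ (by positivity)]
    nlinarith [norm_nonneg y]
  obtain ⟨R, hR1, hRB, hR, hεR⟩ := exists_resolvent hB hε
  have hsmall : ‖ε • R (u t)‖ ≤ δ / 2 := by
    have h1 := hεR (u t - B y)
    have h2 : ‖ε • R (B y)‖ ≤ ε * ‖y‖ := by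
      rw [norm_smul, Real.norm_of_nonneg hε.le, hRB]
      exact mul_le_mul_of_nonneg_left (hR y) hε.le
    have h3 : ε • R (u t) = ε • R (u t - B y) + ε • R (B y) := by
      rw [← smul_add, ← map_add, sub_add_cancel]
    rw [dist_eq_norm] at hy
    rw [h3]
    linarith [norm_add_le (ε • R (u t - B y)) (ε • R (B y))]
  have hint : ∀ t ∈ Icc 0 T, IntervalIntegrable u volume 0 t := fun t ht =>
    (intervalIntegrable_iff_integrableOn_Icc_of_le ht.1).2
      (hu.mono_set (Icc_subset_Icc_right ht.2))
  have hkey : ‖B (B (R (R (u t))))‖ ≤ ‖B (B (R (R (u 0))))‖ := by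
    refine norm_sq_apply_le_of_evolution (u := fun t => R (R (u t))) hB hν ?_ ?_ ht
    · exact (R ∘L R).integrable_comp hu
    · intro t ht
      have h1 := (R ∘L R).intervalIntegral_comp_comm (hint t ht)
      simp only [ContinuousLinearMap.comp_apply] at h1
      rw [h1, ← hRB, ← hRB, h t ht]
      simp only [map_sub, map_smul, hRB]
  have hS : ∀ x, B (B (R (R x))) = B (R (B (R x))) := fun x => by rw [← hRB (R x)]
  rw [hS, hS] at hkey
  have h0 : ‖B (R (B (R (u 0))))‖ ≤ ‖u 0‖ := (hR _).trans (hR _)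
  have h1 : u t = B (R (B (R (u t)))) + B (R (ε • R (u t))) + ε • R (u t) := by
    rw [← map_add, ← map_add, hR1, hR1]
  have h2 : ‖B (R (ε • R (u t)))‖ ≤ δ / 2 := (hR _).trans hsmall
  calc ‖u t‖ ≤ ‖B (R (B (R (u t))))‖ + ‖B (R (ε • R (u t)))‖ + ‖ε • R (u t)‖ := by
        conv_lhs => rw [h1]
        exact norm_add₃_le
    _ ≤ ‖u 0‖ + δ := by linarith

/-- An integrable solution `u`, defined at every time, of the weak evolution equation
`⟪J (u t - u 0), J v⟫ = -ν ∫₀ᵗ (⟪u, v⟫ - ⟪J u, J v⟫)` is norm continuous at the initial time.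
Contractivity, together with the weak convergence `u t ⇀ u 0`, forces strong convergence. -/
lemma tendsto_of_evolution {X : Type*} [NormedAddCommGroup X] [InnerProductSpace ℝ X]
    [CompleteSpace X] {J : H →L[ℝ] X} (hJ : ‖J‖ ≤ 1) (hinj : ∀ x, J x = 0 → x = 0)
    {ν T : ℝ} (hν : 0 ≤ ν) (hT : 0 < T) {u : ℝ → H} (hu : IntegrableOn u (Icc 0 T))
    (h : ∀ t ∈ Icc 0 T, ∀ v, inner ℝ (J (u t - u 0)) (J v) =
      -ν * (inner ℝ (∫ τ in (0 : ℝ)..t, u τ) v - inner ℝ (J (∫ τ in (0 : ℝ)..t, u τ)) (J v))) :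
    Tendsto u (𝓝[>] 0) (𝓝 (u 0)) := by
  set B : H →L[ℝ] H := J.adjoint ∘L J with hBdef
  have hin : ∀ x y, inner ℝ (B x) y = inner ℝ (J x) (J y) := fun x y => by
    simp [hBdef, ContinuousLinearMap.adjoint_inner_left]
  have hB : ∀ x, ‖B x‖ ^ 2 ≤ inner ℝ (B x) x := by
    intro x
    rw [hin, real_inner_self_eq_norm_sq]
    refine pow_le_pow_left₀ (norm_nonneg _) ?_ 2
    refine (J.adjoint.le_opNorm (J x)).trans ?_
    rw [LinearIsometryEquiv.norm_map]
    exact mul_le_of_le_one_left (norm_nonneg _) hJ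
  have hevol : ∀ t ∈ Icc 0 T, B (u t) = B (u 0) -
      ν • ((∫ τ in (0 : ℝ)..t, u τ) - B (∫ τ in (0 : ℝ)..t, u τ)) := by
    intro t ht
    refine ext_inner_right ℝ fun v => ?_
    have := h t ht v
    rw [map_sub, inner_sub_left] at this
    simp only [inner_sub_left, inner_smul_left, hin, conj_trivial]
    linarith
  have hdense : DenseRange B := by
    have : (LinearMap.range (B : H →ₗ[ℝ] H)).topologicalClosure = ⊤ := by
      rw [Submodule.topologicalClosure_eq_top_iff, Submodule.eq_bot_iff]
      intro x hx
      have h1 := (Submodule.mem_orthogonal _ _).1 hx (B x) ⟨x, rfl⟩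
      rw [hin, inner_self_eq_zero] at h1
      exact hinj x h1
    intro x
    have h2 : x ∈ (LinearMap.range (B : H →ₗ[ℝ] H)).topologicalClosure := by rw [this]; trivial
    exact h2
  have hnorm : ∀ t ∈ Icc 0 T, ‖u t‖ ≤ ‖u 0‖ := fun t ht =>
    norm_le_of_evolution hB hdense hν hu hevol ht
  have hmem : ∀ᶠ t in 𝓝[>] (0 : ℝ), t ∈ Icc 0 T := by
    filter_upwards [Ioc_mem_nhdsGT hT] with t ht using Ioc_subset_Icc_self ht
  have hprim : Tendsto (fun t => ∫ τ in (0 : ℝ)..t, u τ) (𝓝[>] 0) (𝓝 0) := by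
    have h1 := intervalIntegral.continuousOn_primitive_interval (a := 0) (b := T) (f := u)
      (μ := volume) (by rwa [uIcc_of_le hT.le])
    rw [uIcc_of_le hT.le] at h1
    have h2 := (h1 0 ⟨le_rfl, hT.le⟩).tendsto
    rw [intervalIntegral.integral_same] at h2
    refine h2.mono_left (nhdsWithin_le_iff.2 ?_)
    exact hmem
  have hBu : Tendsto (fun t => B (u t)) (𝓝[>] 0) (𝓝 (B (u 0))) := by
    have h1 : Tendsto (fun t => B (u 0) - ν • ((∫ τ in (0 : ℝ)..t, u τ) -
        B (∫ τ in (0 : ℝ)..t, u τ))) (𝓝[>] 0) (𝓝 (B (u 0) - ν • (0 - B 0))) :=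
      tendsto_const_nhds.sub ((hprim.sub ((B.continuous.tendsto 0).comp hprim)).const_smul ν)
    simp only [map_zero, sub_zero, smul_zero] at h1
    refine h1.congr' ?_
    filter_upwards [hmem] with t ht using (hevol t ht).symm
  -- convergence of `⟪u t, u 0⟫`: approximate the fixed factor by an element of the range of `B`
  rw [Metric.tendsto_nhds]
  intro ε hε
  set M := ‖u 0‖ + 1
  have hM : 0 < M := by positivity
  obtain ⟨y, hy⟩ := hdense.exists_dist_lt (u 0) (show 0 < ε ^ 2 / (8 * M) by positivity)
  rw [dist_eq_norm] at hy
  have hlim : Tendsto (fun t => inner ℝ (B (u t)) y) (𝓝[>] 0) (𝓝 (inner ℝ (B (u 0)) y)) :=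
    hBu.inner tendsto_const_nhds
  filter_upwards [hmem, Metric.tendsto_nhds.1 hlim (ε ^ 2 / 4) (by positivity)] with t ht hty
  rw [dist_eq_norm, ← sq_lt_sq₀ (norm_nonneg _) hε.le]
  have hsym : ∀ x, inner ℝ (B x) y = inner ℝ x (B y) := fun x => by
    rw [hin, real_inner_comm, ← hin, real_inner_comm]
  rw [hsym, hsym, Real.dist_eq, ← inner_sub_left] at hty
  have h1 : ‖u t - u 0‖ ^ 2 ≤ -2 * inner ℝ (u t - u 0) (u 0) := by
    have h2 : ‖u t‖ ^ 2 ≤ ‖u 0‖ ^ 2 := pow_le_pow_left₀ (norm_nonneg _) (hnorm t ht) 2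
    rw [norm_sub_sq_real, inner_sub_left, real_inner_self_eq_norm_sq]
    linarith
  have h3 : inner ℝ (u t - u 0) (u 0) =
      inner ℝ (u t - u 0) (B y) + inner ℝ (u t - u 0) (u 0 - B y) := by
    rw [← inner_add_right, add_sub_cancel]
  have h4 : |inner ℝ (u t - u 0) (u 0 - B y)| ≤ ε ^ 2 / 4 := by
    refine (abs_real_inner_le_norm _ _).trans ?_
    have h5 : ‖u t - u 0‖ ≤ 2 * M := by
      have := norm_sub_le (u t) (u 0)
      have := hnorm t ht
      simp only [M]
      linarith
    calc ‖u t - u 0‖ * ‖u 0 - B y‖ ≤ (2 * M) * (ε ^ 2 / (8 * M)) := by gcongr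
      _ = ε ^ 2 / 4 := by field_simp; norm_num
  have h6 := neg_abs_le (inner ℝ (u t - u 0) (B y))
  have h7 := neg_abs_le (inner ℝ (u t - u 0) (u 0 - B y))
  linarith

/-- The variant of `tendsto_of_evolution` for solutions with values in a closed subspace `K`, where
the equation is tested with elements of `K` only. -/
lemma tendsto_of_evolution_of_mem {X : Type*} [NormedAddCommGroup X] [InnerProductSpace ℝ X]
    [CompleteSpace X] {K : Submodule ℝ H} (hK : IsClosed (K : Set H)) {J : H →L[ℝ] X}
    (hJ : ‖J‖ ≤ 1) (hinj : ∀ x, J x = 0 → x = 0) {ν T : ℝ} (hν : 0 ≤ ν) (hT : 0 < T) {u : ℝ → H}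
    (hu : IntegrableOn u (Icc 0 T)) (huK : ∀ t ∈ Icc 0 T, u t ∈ K)
    (h : ∀ t ∈ Icc 0 T, ∀ v ∈ K, inner ℝ (J (u t - u 0)) (J v) =
      -ν * (inner ℝ (∫ τ in (0 : ℝ)..t, u τ) v - inner ℝ (J (∫ τ in (0 : ℝ)..t, u τ)) (J v))) :
    Tendsto u (𝓝[>] 0) (𝓝 (u 0)) := by
  have : CompleteSpace K := hK.completeSpace_coe
  set P := K.orthogonalProjectionOnto
  have hP : ∀ t ∈ Icc 0 T, (P (u t) : H) = u t := fun t ht =>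
    Submodule.starProjection_eq_self_iff.2 (huK t ht)
  have hPint : IntegrableOn (fun t => P (u t)) (Icc 0 T) := P.integrable_comp hu
  have hUint : ∀ t ∈ Icc 0 T, ((∫ τ in (0 : ℝ)..t, P (u τ) : K) : H) = ∫ τ in (0 : ℝ)..t, u τ := by
    intro t ht
    have h1 : IntervalIntegrable (fun t => P (u t)) volume 0 t :=
      (intervalIntegrable_iff_integrableOn_Icc_of_le ht.1).2
        (hPint.mono_set (Icc_subset_Icc_right ht.2))
    have h2 := K.subtypeL.intervalIntegral_comp_comm h1
    simp only [Submodule.subtypeL_apply] at h2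
    rw [← h2]
    refine intervalIntegral.integral_congr fun τ hτ => ?_
    rw [uIcc_of_le ht.1] at hτ
    exact hP τ (Icc_subset_Icc_right ht.2 hτ)
  have key : Tendsto (fun t => P (u t)) (𝓝[>] 0) (𝓝 (P (u 0))) := by
    refine tendsto_of_evolution (J := J ∘L K.subtypeL) ?_ (fun v hv => Subtype.ext (hinj _ hv))
      hν hT hPint fun t ht v => ?_
    · refine ContinuousLinearMap.opNorm_le_bound _ zero_le_one fun v => ?_
      exact J.le_of_opNorm_le hJ _
    · have h1 := h t ht v v.2
      rw [← hUint t ht, ← hP t ht, ← hP 0 ⟨le_rfl, hT.le⟩] at h1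
      exact h1
  have h5 := (continuous_subtype_val.tendsto _).comp key
  rw [hP 0 ⟨le_rfl, hT.le⟩] at h5
  refine h5.congr' ?_
  filter_upwards [Ioc_mem_nhdsGT hT] with t ht using hP t (Ioc_subset_Icc_self ht)

end Evolution

/-! ### A field of `H¹₀` determines its weak gradient -/

lemma isClosed_velocitySubmodule (Ω : Set Plane) :
    IsClosed (velocitySubmodule Ω : Set (L2Pair Ω)) :=
  Submodule.isClosed_topologicalClosure _

instance (Ω : Set Plane) : CompleteSpace (Velocity Ω) :=
  (isClosed_velocitySubmodule Ω).completeSpace_coe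

lemma inner_l2Pair {Ω : Set Plane} (z w : L2Pair Ω) :
    inner ℝ z w =
      (∫ x in Ω, inner ℝ (z.fst x) (w.fst x)) + ∫ x in Ω, inner ℝ (z.snd x) (w.snd x) := by
  rw [WithLp.prod_inner_apply, L2.inner_def, L2.inner_def]
  rfl

/-- Integration by parts against a test function, `∫ ψ ∂ⱼvᵢ = -∫ vᵢ ∂ⱼψ`, for the elements
`(v, ∇v)` of `H¹₀`. It says that `(v, ∇v)` is orthogonal in `L²` to a fixed pair, hence passes from
the test pairs to the closure of their span. -/
lemma integral_mul_grad_eq {Ω : Set Plane} {z : L2Pair Ω}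
    (hz : z ∈ velocitySubmodule Ω) {ψ : Plane → ℝ} (hψ : ContDiff ℝ ∞ ψ)
    (hψc : HasCompactSupport ψ) (i j : Fin 2) :
    ∫ x in Ω, ψ x * z.snd x (i, j) =
      -∫ x in Ω, fderiv ℝ ψ x (EuclideanSpace.single j 1) * z.fst x i := by
  set e : Plane := EuclideanSpace.single j 1
  have hdψ : Continuous (fun x => fderiv ℝ ψ x e) :=
    (hψ.continuous_fderiv (by simp)).clm_apply continuous_const
  have hdψc : HasCompactSupport (fun x => fderiv ℝ ψ x e) := hψc.fderiv_apply ℝ e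
  have ha : MemLp (fun x => (fderiv ℝ ψ x e) • (EuclideanSpace.single i 1 : Plane)) 2 (vol Ω) :=
    (ContinuousLinearMap.toSpanSingleton ℝ (EuclideanSpace.single i 1 : Plane)).comp_memLp'
      ((hdψ.memLp_of_hasCompactSupport hdψc (p := 2) (μ := volume)).restrict Ω)
  have hb : MemLp (fun x => ψ x • (EuclideanSpace.single (i, j) 1 : Mat)) 2 (vol Ω) :=
    (ContinuousLinearMap.toSpanSingleton ℝ (EuclideanSpace.single (i, j) 1 : Mat)).comp_memLp'
      ((hψ.continuous.memLp_of_hasCompactSupport hψc (p := 2) (μ := volume)).restrict Ω)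
  set d : L2Pair Ω := WithLp.toLp 2 (ha.toLp, hb.toLp)
  have hinner : ∀ w : L2Pair Ω, inner ℝ w d =
      (∫ x in Ω, fderiv ℝ ψ x e * w.fst x i) + ∫ x in Ω, ψ x * w.snd x (i, j) := by
    intro w
    rw [inner_l2Pair]
    congr 1
    · refine integral_congr_ae ?_
      filter_upwards [ha.coeFn_toLp] with x hx
      change inner ℝ _ (ha.toLp _ x) = _
      rw [hx, inner_smul_right, EuclideanSpace.inner_single_right]
      simp
    · refine integral_congr_ae ?_
      filter_upwards [hb.coeFn_toLp] with x hx
      change inner ℝ _ (hb.toLp _ x) = _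
      rw [hx, inner_smul_right, EuclideanSpace.inner_single_right]
      simp
  have hle : velocitySubmodule Ω ≤
      LinearMap.ker ((innerSL ℝ d : L2Pair Ω →L[ℝ] ℝ) : L2Pair Ω →ₗ[ℝ] ℝ) := by
    refine Submodule.topologicalClosure_minimal _ ?_ (innerSL ℝ d).isClosed_ker
    rw [Submodule.span_le]
    rintro w ⟨φ, hφ, hφc, hφΩ, hw1, hw2⟩
    change inner ℝ d w = 0
    rw [real_inner_comm, hinner]
    have hφd : Continuous (fun x => fderiv ℝ φ x e i) :=
      (EuclideanSpace.proj i : Plane →L[ℝ] ℝ).continuous.comp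
        ((hφ.continuous_fderiv (by simp)).clm_apply continuous_const)
    have hφi : ContDiff ℝ ∞ (fun x => φ x i) :=
      (EuclideanSpace.proj i : Plane →L[ℝ] ℝ).contDiff.comp hφ
    have hfd : ∀ x, fderiv ℝ (fun x => φ x i) x e = fderiv ℝ φ x e i := by
      intro x
      have h1 := ((EuclideanSpace.proj i : Plane →L[ℝ] ℝ).hasFDerivAt.comp x
        ((hφ.differentiable (by simp)) x).hasFDerivAt).fderiv
      exact congrArg (fun f : Plane →L[ℝ] ℝ => f e) h1
    have hφ0 : ∀ x ∉ Ω, φ x = 0 := fun x hx => image_eq_zero_of_notMem_tsupport fun h => hx (hφΩ h)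
    have hφd0 : ∀ x ∉ Ω, fderiv ℝ φ x = 0 := fun x hx =>
      image_eq_zero_of_notMem_tsupport fun h => hx (hφΩ (tsupport_fderiv_subset ℝ h))
    have e1 : ∫ x in Ω, fderiv ℝ ψ x e * w.fst x i = ∫ x, fderiv ℝ ψ x e * φ x i := by
      rw [← setIntegral_eq_integral_of_forall_compl_eq_zero (s := Ω)
        (f := fun x => fderiv ℝ ψ x e * φ x i) (fun x hx => by simp [hφ0 x hx])]
      refine integral_congr_ae ?_
      filter_upwards [hw1] with x hx
      rw [hx]
    have e2 : ∫ x in Ω, ψ x * w.snd x (i, j) = ∫ x, ψ x * fderiv ℝ (fun x => φ x i) x e := by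
      rw [← setIntegral_eq_integral_of_forall_compl_eq_zero (s := Ω)
        (f := fun x => ψ x * fderiv ℝ (fun x => φ x i) x e)
        (fun x hx => by simp [hfd, hφd0 x hx])]
      refine integral_congr_ae ?_
      filter_upwards [hw2 i j] with x hx
      rw [hx, hfd]
    rw [e1, e2, integral_mul_fderiv_eq_neg_fderiv_mul_of_integrable]
    · ring
    · exact (hdψ.mul hφi.continuous).integrable_of_hasCompactSupport hdψc.mul_right
    · simp only [hfd]
      exact (hψ.continuous.mul hφd).integrable_of_hasCompactSupport hψc.mul_right
    · exact (hψ.continuous.mul hφi.continuous).integrable_of_hasCompactSupport hψc.mul_right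
    · exact fun x _ => hψ.differentiable (by simp) x
    · exact fun x _ => hφi.differentiable (by simp) x
  have h0 : inner ℝ z d = 0 := by
    rw [real_inner_comm]
    exact hle hz
  rw [hinner] at h0
  linarith

/-- The embedding of `H¹₀(Ω)²` into `L²(Ω)²`, which forgets the weak gradient. -/
noncomputable def fieldL (Ω : Set Plane) : Velocity Ω →L[ℝ] Lp Plane 2 (vol Ω) :=
  WithLp.fstL 2 ℝ _ _ ∘L (velocitySubmodule Ω).subtypeL

lemma norm_fieldL_le (Ω : Set Plane) : ‖fieldL Ω‖ ≤ 1 := by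
  refine ContinuousLinearMap.opNorm_le_bound _ zero_le_one fun v => ?_
  rw [one_mul]
  exact WithLp.norm_fst_le _ (v : L2Pair Ω)

lemma fieldL_injective {Ω : Set Plane} (hΩ : IsOpen Ω) (v : Velocity Ω) (hv : fieldL Ω v = 0) :
    v = 0 := by
  have h1 : (v : L2Pair Ω).fst = 0 := hv
  have h2 : (v : L2Pair Ω).snd = 0 := by
    rw [Lp.eq_zero_iff_ae_eq_zero]
    have h3 : ∀ k : Fin 2 × Fin 2, ∀ᵐ x ∂(vol Ω), (v : L2Pair Ω).snd x k = 0 := by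
      rintro ⟨i, j⟩
      rw [ae_restrict_iff' hΩ.measurableSet]
      refine hΩ.ae_eq_zero_of_integral_contDiff_smul_eq_zero ?_ ?_
      · refine locallyIntegrableOn_of_locallyIntegrable_restrict ?_
        refine MemLp.locallyIntegrable (p := 2) ?_ (by norm_num)
        exact (EuclideanSpace.proj (i, j) : Mat →L[ℝ] ℝ).comp_memLp' (Lp.memLp (v : L2Pair Ω).snd)
      · intro ψ hψ hψc hψΩ
        rw [← setIntegral_eq_integral_of_forall_compl_eq_zero (s := Ω) (fun x hx => by
          rw [image_eq_zero_of_notMem_tsupport fun h => hx (hψΩ h), zero_smul])]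
        refine (integral_mul_grad_eq v.2 hψ hψc i j).trans ?_
        rw [neg_eq_zero]
        refine integral_eq_zero_of_ae ?_
        rw [h1]
        filter_upwards [Lp.coeFn_zero Plane 2 (vol Ω)] with x hx
        rw [hx]
        simp
    filter_upwards [ae_all_iff.2 h3] with x hx
    ext k
    exact hx k
  refine Subtype.ext ((WithLp.ofLp_injective 2) (Prod.ext h1 h2))

/-! ### Continuity at the initial time of a weak solution of the Stokes problem -/

/-- The pairing with the divergence is the inner product with a fixed pair. -/
lemma exists_bForm_eq_inner {Ω : Set Plane} (q : Pressure Ω) :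
    ∃ d : L2Pair Ω, ∀ v : Velocity Ω, bForm v q = inner ℝ d (v : L2Pair Ω) := by
  set w : Mat := EuclideanSpace.single (0, 0) 1 + EuclideanSpace.single (1, 1) 1
  set D : Lp Mat 2 (vol Ω) :=
    ((ContinuousLinearMap.id ℝ ℝ).smulRight (-w)).compLp (q : Lp ℝ 2 (vol Ω))
  refine ⟨WithLp.toLp 2 (0, D), fun v => ?_⟩
  rw [inner_l2Pair, bForm, ← integral_neg]
  have h1 : ∫ x in Ω, inner ℝ ((WithLp.toLp 2 ((0 : Lp Plane 2 (vol Ω)), D)).fst x)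
      ((v : L2Pair Ω).fst x) = 0 := by
    refine integral_eq_zero_of_ae ?_
    filter_upwards [Lp.coeFn_zero Plane 2 (vol Ω)] with x hx
    change inner ℝ ((0 : Lp Plane 2 (vol Ω)) x) _ = _
    rw [hx]
    simp
  rw [h1, zero_add]
  refine integral_congr_ae ?_
  filter_upwards [((ContinuousLinearMap.id ℝ ℝ).smulRight (-w)).coeFn_compLp
    (q : Lp ℝ 2 (vol Ω))] with x hx
  change _ = inner ℝ (D x) _
  rw [hx]
  simp [w, inner_smul_left, inner_add_left, EuclideanSpace.inner_single_left, Velocity.div,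
    Velocity.grad]
  ring

/-- The weakly divergence free fields of `H¹₀(Ω)²`. -/
def divFree (Ω : Set Plane) : Submodule ℝ (Velocity Ω) where
  carrier := {v | ∀ q, bForm v q = 0}
  zero_mem' q := by
    obtain ⟨d, hd⟩ := exists_bForm_eq_inner q
    simp [hd]
  add_mem' {v w} hv hw q := by
    obtain ⟨d, hd⟩ := exists_bForm_eq_inner q
    have h1 := hv q
    have h2 := hw q
    rw [hd] at h1 h2 ⊢
    rw [Submodule.coe_add, inner_add_right, h1, h2, add_zero]
  smul_mem' c v hv q := by
    obtain ⟨d, hd⟩ := exists_bForm_eq_inner q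
    have h1 := hv q
    rw [hd] at h1 ⊢
    rw [Submodule.coe_smul, inner_smul_right, h1, mul_zero]

lemma isClosed_divFree (Ω : Set Plane) : IsClosed (divFree Ω : Set (Velocity Ω)) := by
  have : (divFree Ω : Set (Velocity Ω)) = ⋂ q, {v | bForm v q = 0} := by
    ext v
    simp [divFree]
  rw [this]
  refine isClosed_iInter fun q => ?_
  obtain ⟨d, hd⟩ := exists_bForm_eq_inner q
  simp only [hd]
  exact isClosed_eq (continuous_const.inner continuous_subtype_val) continuous_const

lemma aForm_one_eq_inner {Ω : Set Plane} (u v : Velocity Ω) :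
    aForm 1 u v = inner ℝ (fieldL Ω u) (fieldL Ω v) := by
  rw [aForm, Nat.cast_one, one_mul, L2.inner_def]
  rfl

lemma lForm_eq_inner {Ω : Set Plane} (Re : ℝ) (u v : Velocity Ω) :
    lForm Re u v = -(1 / Re) * (inner ℝ u v - inner ℝ (fieldL Ω u) (fieldL Ω v)) := by
  have h1 : inner ℝ u v = inner ℝ (fieldL Ω u) (fieldL Ω v) +
      ∫ x in Ω, inner ℝ (u.grad x) (v.grad x) := by
    rw [L2.inner_def]
    exact inner_l2Pair (u : L2Pair Ω) (v : L2Pair Ω)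
  rw [h1, add_sub_cancel_left, lForm]

/-- A weak solution is continuous in the `H¹` norm at the initial time. Tested with divergence free
fields, the pressure drops out and the problem becomes a self-adjoint evolution. -/
theorem IsStokesSolution.tendsto_initial {Ω : Set Plane} (hΩ : IsOpen Ω) {Re T : ℝ} (hRe : 0 < Re)
    (hT : 0 < T) {u : ℝ → Velocity Ω} {p : ℝ → Pressure Ω} (hu : IsStokesSolution Re T u p) :
    Tendsto u (𝓝[>] 0) (𝓝 (u 0)) := by
  have hint : IntegrableOn u (Icc 0 T) := by
    have h1 : IntegrableOn u (Ioc 0 T) := hu.memLp_velocity.integrable (by norm_num)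
    exact integrableOn_Icc_iff_integrableOn_Ioc (by simp) |>.2 h1
  refine tendsto_of_evolution_of_mem (K := divFree Ω) (J := fieldL Ω) (ν := 1 / Re)
    (isClosed_divFree Ω) (norm_fieldL_le Ω) (fieldL_injective hΩ) (by positivity) hT hint
    hu.divergence_free fun t ht v hv => ?_
  set Λ : Velocity Ω →L[ℝ] ℝ := innerSL ℝ v - innerSL ℝ (fieldL Ω v) ∘L fieldL Ω
  have hΛ : ∀ w : Velocity Ω, lForm Re w v = -(1 / Re) * Λ w := by
    intro w
    rw [lForm_eq_inner, real_inner_comm v, real_inner_comm (fieldL Ω v)]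
    rfl
  have h1 := hu.momentum t ht v
  have h2 : ∫ τ in (0 : ℝ)..t, bForm v (p τ) = 0 := by
    rw [intervalIntegral.integral_congr (g := fun _ => (0 : ℝ)) fun τ _ => hv (p τ)]
    simp
  have h3 : ∫ τ in (0 : ℝ)..t, lForm Re (u τ) v = -(1 / Re) * Λ (∫ τ in (0 : ℝ)..t, u τ) := by
    rw [← Λ.intervalIntegral_comp_comm, ← intervalIntegral.integral_const_mul]
    · exact intervalIntegral.integral_congr fun τ _ => hΛ _
    · exact (intervalIntegrable_iff_integrableOn_Icc_of_le ht.1).2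
        (hint.mono_set (Icc_subset_Icc_right ht.2))
  rw [h2, h3, add_zero, aForm_one_eq_inner] at h1
  rw [h1, real_inner_comm v, real_inner_comm (fieldL Ω v)]
  rfl

/-! ### Lipschitz fields with compact support belong to `H¹₀` -/

/-- The matrix of a linear endomorphism of the plane: the gradient matrix of a field is the matrix
of its derivative. -/
noncomputable def gradL : (Plane →L[ℝ] Plane) →L[ℝ] Mat :=
  LinearMap.toContinuousLinearMap
    { toFun := fun A => WithLp.toLp 2 fun k => A (EuclideanSpace.single k.2 1) k.1
      map_add' := fun _ _ => rfl
      map_smul' := fun _ _ => rfl }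

lemma gradL_apply (A : Plane →L[ℝ] Plane) (i j : Fin 2) :
    gradL A (i, j) = A (EuclideanSpace.single j 1) i := rfl

/-- Bounded convergence in `L²` of a finite measure. -/
lemma tendsto_toLp_of_bounded {α E : Type*} [MeasurableSpace α] {μ : Measure α} [IsFiniteMeasure μ]
    [NormedAddCommGroup E] {f : ℕ → α → E} {g : α → E} {M : ℝ} (hf : ∀ n, MemLp (f n) 2 μ)
    (hg : MemLp g 2 μ) (hM : ∀ n x, ‖f n x‖ ≤ M)
    (hlim : ∀ᵐ x ∂μ, Tendsto (fun n => f n x) atTop (𝓝 (g x))) :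
    Tendsto (fun n => (hf n).toLp (f n)) atTop (𝓝 (hg.toLp g)) := by
  rw [Lp.tendsto_Lp_iff_tendsto_eLpNorm'']
  refine tendsto_Lp_finite_of_tendsto_ae (by norm_num) (by norm_num) (fun n => (hf n).1) hg ?_ hlim
  refine unifIntegrable_of (by norm_num) (by norm_num) (fun n => (hf n).1) fun ε _ =>
    ⟨(M + 1).toNNReal, fun n => ?_⟩
  have : {x | (M + 1).toNNReal ≤ ‖f n x‖₊} = ∅ := by
    refine eq_empty_of_forall_notMem fun x hx => ?_
    have h1 := (Real.toNNReal_le_iff_le_coe.1 hx).trans (hM n x)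
    linarith
  rw [this, indicator_empty]
  exact eLpNorm_zero.trans_le zero_le

/-- Mollification commutes with the (almost everywhere defined) derivative of a Lipschitz
function. -/
lemma hasFDerivAt_convolution_of_lipschitz {φ : Plane → ℝ} (hφ : Continuous φ)
    (hφc : HasCompactSupport φ) {g : Plane → Plane} {K : NNReal} (hg : LipschitzWith K g)
    (x : Plane) :
    HasFDerivAt (convolution φ g (ContinuousLinearMap.lsmul ℝ ℝ) volume)
      (convolution φ (fderiv ℝ g) (ContinuousLinearMap.lsmul ℝ ℝ) volume x) x := by
  have hsub : ∀ y : Plane, Continuous (fun t => g (y - t)) := fun y =>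
    hg.continuous.comp (continuous_const.sub continuous_id)
  refine (hasFDerivAt_integral_of_dominated_loc_of_lip (bound := fun t => |φ t| * K)
    (F := fun y t => φ t • g (y - t)) (F' := fun t => φ t • fderiv ℝ g (x - t))
    univ_mem ?_ ?_ ?_ ?_ ?_ ?_).2
  · exact Eventually.of_forall fun y => (hφ.smul (hsub y)).aestronglyMeasurable
  · exact (hφ.smul (hsub x)).integrable_of_hasCompactSupport hφc.smul_right
  · exact hφ.aestronglyMeasurable.smul
      ((measurable_fderiv ℝ g).comp (measurable_const.sub measurable_id)).aestronglyMeasurable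
  · refine Eventually.of_forall fun t => LipschitzWith.lipschitzOnWith ?_
    refine LipschitzWith.of_dist_le_mul fun y z => ?_
    rw [dist_smul₀, Real.norm_eq_abs, Real.coe_nnabs, abs_mul, abs_abs, NNReal.abs_eq, mul_assoc]
    refine mul_le_mul_of_nonneg_left ?_ (abs_nonneg _)
    simpa using hg.dist_le_mul (y - t) (z - t)
  · exact (hφ.abs.mul continuous_const).integrable_of_hasCompactSupport hφc.norm.mul_right
  · have hmp := Measure.measurePreserving_sub_left (volume : Measure Plane) x
    have h1 := hmp.quasiMeasurePreserving.ae
      (hg.ae_differentiableAt (μ := volume))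
    filter_upwards [h1] with t ht
    have h2 : HasFDerivAt (fun y => g (y - t)) (fderiv ℝ g (x - t)) x := by
      have h3 := ht.hasFDerivAt.comp x ((hasFDerivAt_id x).sub_const t)
      rwa [ContinuousLinearMap.comp_id] at h3
    exact h2.const_smul (φ t)

/-- Convolution with a normalized bump function does not increase the supremum norm. -/
lemma norm_convolution_normed_le {E : Type*} [NormedAddCommGroup E] [NormedSpace ℝ E]
    (φ : ContDiffBump (0 : Plane)) {f : Plane → E} {M : ℝ} (hM : ∀ x, ‖f x‖ ≤ M) (x : Plane) :
    ‖convolution (φ.normed volume) f (ContinuousLinearMap.lsmul ℝ ℝ) volume x‖ ≤ M := by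
  rw [convolution_def]
  have h1 : Integrable (fun t => φ.normed volume t * M) :=
    φ.integrable_normed.mul_const M
  refine (norm_integral_le_of_norm_le h1 (Eventually.of_forall fun t => ?_)).trans ?_
  · rw [ContinuousLinearMap.lsmul_apply, norm_smul, Real.norm_of_nonneg (φ.nonneg_normed t)]
    exact mul_le_mul_of_nonneg_left (hM _) (φ.nonneg_normed t)
  · rw [integral_mul_const, φ.integral_normed, one_mul]

lemma tsupport_convolution_normed_subset (φ : ContDiffBump (0 : Plane)) (g : Plane → Plane) :
    tsupport (convolution (φ.normed volume) g (ContinuousLinearMap.lsmul ℝ ℝ) volume) ⊆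
      Metric.cthickening φ.rOut (tsupport g) := by
  refine closure_minimal ?_ Metric.isClosed_cthickening
  refine (support_convolution_subset _).trans ?_
  rintro _ ⟨a, ha, b, hb, rfl⟩
  rw [φ.support_normed_eq, mem_ball_zero_iff] at ha
  refine Metric.mem_cthickening_of_dist_le _ b _ _ (subset_tsupport _ hb) ?_
  simpa using ha.le

/-- The weak gradient of a compactly supported Lipschitz field is its almost everywhere derivative,
and the field belongs to `H¹₀(Ω)²`: its mollifications are test fields, and they converge together
with their derivatives, boundedly and almost everywhere. -/
lemma exists_velocity_of_lipschitz {Ω : Set Plane} (hΩ : IsOpen Ω) (hfin : volume Ω ≠ ⊤)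
    {g : Plane → Plane} {K : NNReal} (hg : LipschitzWith K g) (hgc : HasCompactSupport g)
    (hgΩ : tsupport g ⊆ Ω) :
    ∃ v : Velocity Ω, v.field =ᵐ[vol Ω] g ∧ v.grad =ᵐ[vol Ω] fun x => gradL (fderiv ℝ g x) := by
  have : IsFiniteMeasure (vol Ω) := ⟨by simpa using hfin.lt_top⟩
  obtain ⟨M, hM⟩ := hgc.exists_bound_of_continuous hg.continuous
  have hK : ∀ x, ‖fderiv ℝ g x‖ ≤ K := fun x => norm_fderiv_le_of_lipschitz ℝ hg
  have hgl : LocallyIntegrable g := hg.continuous.locallyIntegrable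
  have hdl : LocallyIntegrable (fderiv ℝ g) :=
    (memLp_top_of_bound (measurable_fderiv ℝ g).aestronglyMeasurable K
      (Eventually.of_forall hK)).locallyIntegrable le_top
  have hmg : MemLp g 2 (vol Ω) :=
    MemLp.of_bound hg.continuous.aestronglyMeasurable M (Eventually.of_forall hM)
  have hGb : ∀ A : Plane →L[ℝ] Plane, ‖A‖ ≤ K → ‖gradL A‖ ≤ ‖gradL‖ * K := fun A hA =>
    (gradL.le_opNorm A).trans (mul_le_mul_of_nonneg_left hA (norm_nonneg _))
  have hmd : MemLp (fun x => gradL (fderiv ℝ g x)) 2 (vol Ω) :=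
    MemLp.of_bound (gradL.continuous.measurable.comp (measurable_fderiv ℝ g)).aestronglyMeasurable
      (‖gradL‖ * K) (Eventually.of_forall fun x => hGb _ (hK x))
  obtain ⟨δ, hδ, hδΩ⟩ := hgc.isCompact.exists_cthickening_subset_open hΩ hgΩ
  -- bump functions of outer radius `δ / (n + 1)`
  set φ : ℕ → ContDiffBump (0 : Plane) := fun n =>
    ⟨δ / (2 * (n + 1)), δ / (n + 1), by positivity, by
      apply div_lt_div_of_pos_left hδ <;>
        first | positivity | linarith [(n.cast_nonneg : (0 : ℝ) ≤ n)]⟩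
  have hφlim : Tendsto (fun n => (φ n).rOut) atTop (𝓝 0) := by
    simpa [φ, div_eq_mul_inv] using (tendsto_one_div_add_atTop_nhds_zero_nat (𝕜 := ℝ)).const_mul δ
  have hφK : ∀ᶠ n in atTop, (φ n).rOut ≤ 2 * (φ n).rIn := Eventually.of_forall fun n => by
    simp only [φ]
    apply le_of_eq
    field_simp
  have hφδ : ∀ n, (φ n).rOut ≤ δ := fun n => by
    simp only [φ]
    exact div_le_self hδ.le (by linarith [(n.cast_nonneg : (0:ℝ) ≤ n)])
  set f : ℕ → Plane → Plane := fun n =>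
    convolution ((φ n).normed volume) g (ContinuousLinearMap.lsmul ℝ ℝ) volume
  have hder : ∀ n x, HasFDerivAt (f n) (convolution ((φ n).normed volume) (fderiv ℝ g)
      (ContinuousLinearMap.lsmul ℝ ℝ) volume x) x := fun n x =>
    hasFDerivAt_convolution_of_lipschitz (φ n).continuous_normed (φ n).hasCompactSupport_normed hg x
  have hfs : ∀ n, ContDiff ℝ ∞ (f n) := fun n =>
    (φ n).hasCompactSupport_normed.contDiff_convolution_left _ (φ n).contDiff_normed hgl
  have hfM : ∀ n x, ‖f n x‖ ≤ M := fun n x => norm_convolution_normed_le _ hM x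
  have hdM : ∀ n x, ‖gradL (fderiv ℝ (f n) x)‖ ≤ ‖gradL‖ * K := fun n x => by
    rw [(hder n x).fderiv]
    exact hGb _ (norm_convolution_normed_le _ hK x)
  have hmf : ∀ n, MemLp (f n) 2 (vol Ω) := fun n =>
    MemLp.of_bound (hfs n).continuous.aestronglyMeasurable M (Eventually.of_forall (hfM n))
  have hmdf : ∀ n, MemLp (fun x => gradL (fderiv ℝ (f n) x)) 2 (vol Ω) := fun n =>
    MemLp.of_bound (gradL.continuous.measurable.comp (measurable_fderiv ℝ _)).aestronglyMeasurable
      (‖gradL‖ * K) (Eventually.of_forall (hdM n))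
  have hsupp : ∀ n, tsupport (f n) ⊆ Metric.cthickening δ (tsupport g) := fun n =>
    (tsupport_convolution_normed_subset _ _).trans (Metric.cthickening_mono (hφδ n) _)
  have htest : ∀ n, IsTestPair Ω (WithLp.toLp 2 ((hmf n).toLp, (hmdf n).toLp)) := fun n =>
    ⟨f n, hfs n, hgc.isCompact.cthickening.of_isClosed_subset (isClosed_tsupport _) (hsupp n),
      (hsupp n).trans hδΩ, (hmf n).coeFn_toLp, fun i j => by
        filter_upwards [(hmdf n).coeFn_toLp] with x hx
        change ((hmdf n).toLp _ x) (i, j) = _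
        rw [hx, gradL_apply]⟩
  have hlim : Tendsto (fun n => (WithLp.toLp 2 ((hmf n).toLp, (hmdf n).toLp) : L2Pair Ω)) atTop
      (𝓝 (WithLp.toLp 2 (hmg.toLp, hmd.toLp))) := by
    refine ((WithLp.prod_continuous_toLp 2 _ _).tendsto _).comp (Tendsto.prodMk_nhds ?_ ?_)
    · exact tendsto_toLp_of_bounded hmf hmg hfM (ae_restrict_of_ae
        (ContDiffBump.ae_convolution_tendsto_right_of_locallyIntegrable hφlim hφK hgl))
    · refine tendsto_toLp_of_bounded hmdf hmd hdM (ae_restrict_of_ae ?_)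
      filter_upwards [ContDiffBump.ae_convolution_tendsto_right_of_locallyIntegrable
        (μ := volume) hφlim hφK hdl] with x hx
      refine ((gradL.continuous.tendsto _).comp hx).congr fun n => ?_
      rw [Function.comp_apply, (hder n x).fderiv]
  have hmem : (WithLp.toLp 2 (hmg.toLp, hmd.toLp) : L2Pair Ω) ∈ velocitySubmodule Ω :=
    (isClosed_velocitySubmodule Ω).mem_of_tendsto hlim (Eventually.of_forall fun n =>
      Submodule.le_topologicalClosure _ (Submodule.subset_span (htest n)))
  exact ⟨⟨_, hmem⟩, hmg.coeFn_toLp, hmd.coeFn_toLp⟩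

/-! ### Lipschitz functions on a finite closed cover -/

/-- A function that is Lipschitz on each set of a finite closed cover of an interval is Lipschitz
between its end points: starting at `a`, go to the last point of the first set containing `a`, from
which on that set is no longer needed. -/
lemma dist_le_of_finite_closed_cover {ι F : Type*} [PseudoMetricSpace F] {f : ℝ → F} {K : NNReal}
    {A : ι → Set ℝ} (s : Finset ι) (hA : ∀ i ∈ s, IsClosed (A i))
    (hf : ∀ i ∈ s, LipschitzOnWith K f (A i)) {a b : ℝ} (hab : a ≤ b)
    (hcov : Icc a b ⊆ ⋃ i ∈ s, A i) : dist (f a) (f b) ≤ K * (b - a) := by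
  classical
  induction s using Finset.strongInduction generalizing a with
  | H s ih =>
    obtain ⟨i, hi, hai⟩ : ∃ i ∈ s, a ∈ A i := by simpa using hcov (left_mem_Icc.2 hab)
    have hcomp : IsCompact (A i ∩ Icc a b) := isCompact_Icc.inter_left (hA i hi)
    have hne : (A i ∩ Icc a b).Nonempty := ⟨a, hai, left_mem_Icc.2 hab⟩
    set c := sSup (A i ∩ Icc a b)
    obtain ⟨hcA, hac, hcb⟩ : c ∈ A i ∩ Icc a b := hcomp.sSup_mem hne
    have h1 : dist (f a) (f c) ≤ K * (c - a) := by
      have := (hf i hi).dist_le_mul a hai c hcA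
      rwa [dist_comm a, Real.dist_eq, abs_of_nonneg (sub_nonneg.2 hac)] at this
    rcases hcb.eq_or_lt with hcb' | hcb'
    · rwa [hcb'] at h1
    have h2 : Ioc c b ⊆ ⋃ j ∈ s.erase i, A j := by
      intro x hx
      obtain ⟨j, hj, hxj⟩ : ∃ j ∈ s, x ∈ A j := by
        simpa using hcov ⟨hac.trans hx.1.le, hx.2⟩
      have hji : j ≠ i := by
        rintro rfl
        exact (le_csSup hcomp.bddAbove ⟨hxj, hac.trans hx.1.le, hx.2⟩).not_gt hx.1
      exact mem_biUnion (Finset.mem_coe.2 (Finset.mem_erase.2 ⟨hji, hj⟩)) hxj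
    have h3 : IsClosed (⋃ j ∈ s.erase i, A j) :=
      (s.erase i).finite_toSet.isClosed_biUnion fun j hj => hA j (Finset.mem_of_mem_erase hj)
    have h4 : Icc c b ⊆ ⋃ j ∈ s.erase i, A j := by
      rw [← closure_Ioc hcb'.ne]
      exact closure_minimal h2 h3
    have h5 := ih (s.erase i) (Finset.erase_ssubset hi)
      (fun j hj => hA j (Finset.mem_of_mem_erase hj))
      (fun j hj => hf j (Finset.mem_of_mem_erase hj)) hcb h4
    linarith [dist_triangle (f a) (f c) (f b)]

lemma lipschitzWith_of_finite_closed_cover {ι E F : Type*} [NormedAddCommGroup E] [NormedSpace ℝ E]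
    [PseudoMetricSpace F] {f : E → F} {K : NNReal} {A : ι → Set E} (s : Finset ι)
    (hA : ∀ i ∈ s, IsClosed (A i)) (hf : ∀ i ∈ s, LipschitzOnWith K f (A i))
    (hcov : ∀ x, ∃ i ∈ s, x ∈ A i) : LipschitzWith K f := by
  refine LipschitzWith.of_dist_le_mul fun x y => ?_
  have h1 := dist_le_of_finite_closed_cover (f := fun t : ℝ => f (AffineMap.lineMap x y t))
    (K := K * nndist x y) (A := fun i => (fun t : ℝ => AffineMap.lineMap x y t) ⁻¹' (A i)) s
    (fun i hi => (hA i hi).preimage AffineMap.lineMap_continuous)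
    (fun i hi => LipschitzOnWith.of_dist_le_mul fun t ht t' ht' => by
      refine ((hf i hi).dist_le_mul _ ht _ ht').trans ?_
      rw [dist_lineMap_lineMap, NNReal.coe_mul, coe_nndist]
      exact le_of_eq (by ring))
    zero_le_one (fun t _ => by simpa using hcov (AffineMap.lineMap x y t))
  simpa using h1

/-! ### Affine interpolation on a triangle -/

/-- The derivative of an affine map of the plane. -/
noncomputable def affineDeriv (ℓ : Plane →ᵃ[ℝ] Plane) : Plane →L[ℝ] Plane :=
  LinearMap.toContinuousLinearMap ℓ.linear

lemma affineDeriv_sub (ℓ : Plane →ᵃ[ℝ] Plane) (x y : Plane) :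
    affineDeriv ℓ (x - y) = ℓ x - ℓ y := ℓ.linearMap_vsub x y

lemma affine_eq (ℓ : Plane →ᵃ[ℝ] Plane) (x : Plane) : ℓ x = affineDeriv ℓ x + ℓ 0 := by
  have := affineDeriv_sub ℓ x 0
  rw [sub_zero] at this
  rw [this, sub_add_cancel]

lemma hasFDerivAt_affine (ℓ : Plane →ᵃ[ℝ] Plane) (x : Plane) :
    HasFDerivAt ℓ (affineDeriv ℓ) x := by
  have h1 : (ℓ : Plane → Plane) = fun x => affineDeriv ℓ x + ℓ 0 := funext (affine_eq ℓ)
  rw [h1]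
  exact (affineDeriv ℓ).hasFDerivAt.add_const _

lemma lipschitzWith_affine (ℓ : Plane →ᵃ[ℝ] Plane) : LipschitzWith ‖affineDeriv ℓ‖₊ ℓ := by
  refine LipschitzWith.of_dist_le_mul fun x y => ?_
  rw [dist_eq_norm, dist_eq_norm, ← affineDeriv_sub]
  exact (affineDeriv ℓ).le_opNorm _

/-- Values prescribed at the vertices of a nondegenerate triangle are taken by an affine map. -/
lemma exists_affine_interpolant {K : Finset Plane} (hK : AffineIndependent ℝ ((↑) : K → Plane))
    (hcard : K.card = 3) (f : Plane → Plane) : ∃ ℓ : Plane →ᵃ[ℝ] Plane, ∀ v ∈ K, ℓ v = f v := by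
  classical
  let b : AffineBasis K ℝ Plane := ⟨(↑), hK, by
    rw [hK.affineSpan_eq_top_iff_card_eq_finrank_add_one]
    simp [hcard]⟩
  refine ⟨∑ i : K, (LinearMap.toSpanSingleton ℝ Plane (f i)).toAffineMap.comp (b.coord i),
    fun v hv => ?_⟩
  have hb : b ⟨v, hv⟩ = v := rfl
  have h1 : ∀ i : K, b.coord i v = if i = ⟨v, hv⟩ then 1 else 0 := fun i => by
    conv_lhs => rw [← hb, AffineBasis.coord_apply]
  have h2 : (∑ i : K, (LinearMap.toSpanSingleton ℝ Plane (f i)).toAffineMap.comp (b.coord i)) v =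
      ∑ i : K, b.coord i v • f i := by
    let ev : (Plane →ᵃ[ℝ] Plane) →+ Plane :=
      { toFun := fun B => B v
        map_zero' := rfl
        map_add' := fun _ _ => rfl }
    exact map_sum ev _ _
  rw [h2]
  simp [h1]

lemma isCompact_triangle (K : Finset Plane) : IsCompact (triangle K) :=
  K.finite_toSet.isCompact_convexHull ℝ

lemma dist_le_diam_triangle {K : Finset Plane} {x y : Plane} (hx : x ∈ triangle K)
    (hy : y ∈ triangle K) : dist x y ≤ Metric.diam (triangle K) :=
  Metric.dist_le_diam_of_mem (isCompact_triangle K).isBounded hx hy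

lemma mem_triangle_of_mem {K : Finset Plane} {v : Plane} (hv : v ∈ K) : v ∈ triangle K :=
  subset_convexHull ℝ _ hv

/-- Interpolation error on a triangle `K` that contains a disc of radius `ρ ≥ diam K / κ`, for a
field whose derivative is `M`-Lipschitz. The interpolant differs from the Taylor polynomial at a
vertex by an affine map of size `M diam²` at the vertices, hence on `K`; on the disc such a map can
only vary by as much if its derivative is at most `2 M diam² / ρ`. -/
lemma interpolation_error {K : Finset Plane} {f : Plane → Plane} (hf : Differentiable ℝ f)
    {M : NNReal} (hM : LipschitzWith M (fderiv ℝ f)) {ℓ : Plane →ᵃ[ℝ] Plane}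
    (hℓ : ∀ v ∈ K, ℓ v = f v) {c : Plane} {ρ κ : ℝ} (hρ : 0 < ρ)
    (hball : Metric.closedBall c ρ ⊆ triangle K) (hκ : Metric.diam (triangle K) ≤ κ * ρ)
    {x : Plane} (hx : x ∈ triangle K) :
    ‖ℓ x - f x‖ ≤ 2 * M * Metric.diam (triangle K) ^ 2 ∧
      ‖affineDeriv ℓ - fderiv ℝ f x‖ ≤ (2 * κ + 1) * M * Metric.diam (triangle K) := by
  set d := Metric.diam (triangle K)
  have hd : 0 ≤ d := Metric.diam_nonneg
  obtain ⟨v₀, hv₀⟩ : K.Nonempty := by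
    have h1 : (triangle K).Nonempty := ⟨x, hx⟩
    simpa [triangle] using h1
  have hv₀' := mem_triangle_of_mem hv₀
  set L₀ := fderiv ℝ f v₀
  have hL : ∀ y ∈ triangle K, ‖fderiv ℝ f y - L₀‖ ≤ M * d := fun y hy => by
    rw [← dist_eq_norm]
    exact (hM.dist_le_mul _ _).trans
      (mul_le_mul_of_nonneg_left (dist_le_diam_triangle hy hv₀') M.2)
  have hTaylor : ∀ y ∈ triangle K, ‖f y - f v₀ - L₀ (y - v₀)‖ ≤ M * d ^ 2 := fun y hy => by
    refine ((convex_convexHull ℝ _).norm_image_sub_le_of_norm_fderiv_le' (fun z _ => hf z) hL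
      hv₀' hy).trans ?_
    rw [← dist_eq_norm, sq, ← mul_assoc]
    exact mul_le_mul_of_nonneg_left (dist_le_diam_triangle hy hv₀') (by positivity)
  -- the affine difference between the interpolant and the Taylor polynomial
  set A : Plane →ᵃ[ℝ] Plane :=
    ℓ - (L₀ : Plane →ₗ[ℝ] Plane).toAffineMap - AffineMap.const ℝ Plane (f v₀ - L₀ v₀)
  have hA : ∀ y, A y = ℓ y - f v₀ - L₀ (y - v₀) := fun y => by
    simp [A]
    abel
  have hAle : ∀ y ∈ triangle K, ‖A y‖ ≤ M * d ^ 2 := by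
    have h1 : triangle K ⊆ A ⁻¹' Metric.closedBall 0 (M * d ^ 2) := by
      refine convexHull_min (fun v hv => ?_) ((convex_closedBall _ _).affine_preimage A)
      rw [mem_preimage, mem_closedBall_zero_iff, hA, hℓ v hv]
      exact hTaylor v (mem_triangle_of_mem hv)
    intro y hy
    simpa using h1 hy
  constructor
  · have h1 : ℓ x - f x = A x - (f x - f v₀ - L₀ (x - v₀)) := by
      rw [hA]
      abel
    rw [h1]
    linarith [norm_sub_le (A x) (f x - f v₀ - L₀ (x - v₀)), hAle x hx, hTaylor x hx]
  · have h1 : ‖affineDeriv ℓ - L₀‖ ≤ 2 * κ * M * d := by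
      have hκ0 : 0 ≤ κ := nonneg_of_mul_nonneg_left (hd.trans hκ) hρ
      refine ContinuousLinearMap.opNorm_le_of_unit_norm (by positivity) fun w hw => ?_
      have hc : c ∈ triangle K := hball (Metric.mem_closedBall_self hρ.le)
      have hcw : c + ρ • w ∈ triangle K := hball (by
        simp [norm_smul, hw, abs_of_pos hρ])
      have h2 : ρ • (affineDeriv ℓ - L₀) w = A (c + ρ • w) - A c := by
        rw [hA, hA, sub_apply, affine_eq ℓ (c + ρ • w), affine_eq ℓ c]
        simp only [map_add, map_sub, map_smul, smul_sub]
        abel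
      have h3 : ρ * ‖(affineDeriv ℓ - L₀) w‖ ≤ 2 * M * d ^ 2 := by
        have h4 : ρ * ‖(affineDeriv ℓ - L₀) w‖ = ‖ρ • (affineDeriv ℓ - L₀) w‖ := by
          rw [norm_smul, Real.norm_of_nonneg hρ.le]
        rw [h4, h2]
        linarith [norm_sub_le (A (c + ρ • w)) (A c), hAle _ hcw, hAle _ hc]
      have h5 : 2 * M * d ^ 2 ≤ ρ * (2 * κ * M * d) := by
        calc 2 * M * d ^ 2 = (2 * M * d) * d := by ring
          _ ≤ (2 * M * d) * (κ * ρ) := by gcongr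
          _ = ρ * (2 * κ * M * d) := by ring
      exact le_of_mul_le_mul_left (h3.trans h5) hρ
    have h2 : affineDeriv ℓ - fderiv ℝ f x = (affineDeriv ℓ - L₀) - (fderiv ℝ f x - L₀) := by abel
    rw [h2]
    linarith [norm_sub_le (affineDeriv ℓ - L₀) (fderiv ℝ f x - L₀), hL x hx]

/-! ### The nodal interpolant on a triangulation -/

namespace Triangulation

variable {Ω : Set Plane} (𝒯 : Triangulation Ω)

lemma finite_cells : 𝒯.cells.Finite := 𝒯.finite_faces.subset fun _ h => h.1

lemma exists_cell_of_mem_closure {x : Plane} (hx : x ∈ closure Ω) :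
    ∃ K ∈ 𝒯.cells, x ∈ triangle K := by
  rw [← 𝒯.space_eq, Geometry.SimplicialComplex.mem_space_iff] at hx
  obtain ⟨e, he, hxe⟩ := hx
  obtain ⟨K, hK, heK, hcard⟩ := 𝒯.exists_triangle e he
  exact ⟨K, ⟨hK, hcard⟩, convexHull_mono (Finset.coe_subset.2 heK) hxe⟩

lemma volume_ne_top (𝒯 : Triangulation Ω) : volume Ω ≠ ⊤ := by
  have h1 : Ω ⊆ ⋃ K ∈ 𝒯.cells, triangle K := fun x hx => by
    obtain ⟨K, hK, hxK⟩ := 𝒯.exists_cell_of_mem_closure (subset_closure hx)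
    exact mem_biUnion hK hxK
  exact ((measure_mono h1).trans_lt
    (𝒯.finite_cells.isCompact_biUnion fun K _ => isCompact_triangle K).measure_lt_top).ne

/-- Almost every point of `Ω` is interior to a triangle. -/
lemma ae_mem_interior (hΩ : IsOpen Ω) :
    ∀ᵐ x ∂(vol Ω), ∃ K ∈ 𝒯.cells, x ∈ interior (triangle K) := by
  have h1 : ∀ᵐ x : Plane, ∀ K ∈ 𝒯.cells, x ∉ frontier (triangle K) := by
    rw [ae_ball_iff 𝒯.finite_cells.countable]
    intro K _
    exact measure_eq_zero_iff_ae_notMem.1 ((convex_convexHull ℝ _).addHaar_frontier volume)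
  filter_upwards [ae_restrict_of_ae h1, ae_restrict_mem hΩ.measurableSet] with x hx hxΩ
  obtain ⟨K, hK, hxK⟩ := 𝒯.exists_cell_of_mem_closure (subset_closure hxΩ)
  refine ⟨K, hK, ?_⟩
  by_contra h
  exact hx K hK ⟨subset_closure hxK, h⟩

/-- In a shape regular triangulation each triangle contains a disc of comparable size. -/
lemma ShapeRegular.exists_closedBall_subset {𝒯 : Triangulation Ω} {σ : ℝ} (hσ : 𝒯.ShapeRegular σ)
    {K : Finset Plane} (hK : K ∈ 𝒯.cells) : ∃ (c : Plane) (ρ : ℝ), 0 < ρ ∧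
      Metric.closedBall c ρ ⊆ triangle K ∧ Metric.diam (triangle K) ≤ 2 * σ * ρ := by
  have hdiam : 0 < Metric.diam (triangle K) := by
    obtain ⟨a, ha, b, hb, hab⟩ := Finset.one_lt_card.1 (by rw [hK.2]; norm_num : 1 < K.card)
    exact (dist_pos.2 hab).trans_le
      (dist_le_diam_triangle (mem_triangle_of_mem ha) (mem_triangle_of_mem hb))
  have hreg := hσ K hK
  have hnonneg : 0 ≤ inradius K := Real.sSup_nonneg fun ρ hρ => hρ.1
  have hpos : 0 < inradius K := by
    refine hnonneg.lt_of_ne fun h => ?_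
    rw [← h, mul_zero] at hreg
    exact hdiam.not_ge hreg
  have hσ0 : 0 < σ := pos_of_mul_pos_left (hdiam.trans_le hreg) hnonneg
  have hne : {ρ : ℝ | 0 ≤ ρ ∧ ∃ c : Plane, Metric.closedBall c ρ ⊆ triangle K}.Nonempty := by
    rw [nonempty_iff_ne_empty]
    intro h
    rw [inradius, h, Real.sSup_empty] at hpos
    exact hpos.false
  obtain ⟨ρ, ⟨-, c, hc⟩, hlt⟩ := exists_lt_of_lt_csSup hne (half_lt_self hpos)
  have hlt' : inradius K / 2 < ρ := hlt
  exact ⟨c, ρ, (half_pos hpos).trans hlt', hc, hreg.trans (by nlinarith)⟩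

lemma ShapeRegular.diam_le {𝒯 : Triangulation Ω} {σ : ℝ} (hσ : 𝒯.ShapeRegular σ)
    {K : Finset Plane} (hK : K ∈ 𝒯.cells) :
    Metric.diam (triangle K) ≤ |σ| * |𝒯.meshSize| := by
  have h1 : inradius K ≤ 𝒯.meshSize :=
    le_csSup (𝒯.finite_cells.image _).bddAbove (mem_image_of_mem _ hK)
  have h2 : 0 ≤ inradius K := Real.sSup_nonneg fun ρ hρ => hρ.1
  calc Metric.diam (triangle K) ≤ σ * inradius K := hσ K hK
    _ ≤ |σ| * |𝒯.meshSize| :=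
      mul_le_mul (le_abs_self _) (h1.trans (le_abs_self _)) h2 (abs_nonneg _)

/-- A field that is affine on each triangle and continuous on the closure of `Ω` is piecewise
polynomial of every positive degree. -/
lemma isPiecewisePoly_of_affine {g : Plane → Plane} (hg : Continuous g)
    {ℓ : Finset Plane → Plane →ᵃ[ℝ] Plane} (hℓ : ∀ K ∈ 𝒯.cells, EqOn g (ℓ K) (triangle K))
    {s : ℕ} (hs : 1 ≤ s) (i : Fin 2) : 𝒯.IsPiecewisePoly s fun x => g x i := by
  refine ⟨((EuclideanSpace.proj i : Plane →L[ℝ] ℝ).continuous.comp hg).continuousOn,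
    fun K hK => ?_⟩
  refine ⟨MvPolynomial.C (ℓ K 0 i) + ∑ j : Fin 2, MvPolynomial.C
    (affineDeriv (ℓ K) (EuclideanSpace.single j 1) i) * MvPolynomial.X j, ?_, fun x hx => ?_⟩
  · refine (MvPolynomial.totalDegree_add _ _).trans (max_le (by simp) ?_)
    refine MvPolynomial.totalDegree_finsetSum_le fun j _ => ?_
    refine (MvPolynomial.totalDegree_mul _ _).trans ?_
    simpa using hs
  · simp only
    rw [hℓ K hK hx, affine_eq]
    have h1 : x = ∑ j : Fin 2, x j • (EuclideanSpace.single j 1 : Plane) := by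
      ext k
      fin_cases k <;> simp
    conv_lhs => rw [h1]
    simp [mul_comm]
    ring

/-- The nodal interpolant of a field `f` supported well inside `Ω`, extended by zero to the plane.
By conformity it is well defined: two triangles meet in the convex hull of their common vertices, on
which their affine interpolants agree. It vanishes outside `Ω` since all vertices of a triangle that
leaves `Ω` lie outside the support of `f`; hence it is Lipschitz, being so on each triangle and on
the complement of `Ω`. -/
lemma exists_nodal_interpolant (hΩ : IsOpen Ω) {f : Plane → Plane} (hfc : HasCompactSupport f)
    {δ : ℝ} (hδ : Metric.cthickening δ (tsupport f) ⊆ Ω)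
    (hdiam : ∀ K ∈ 𝒯.cells, Metric.diam (triangle K) ≤ δ) :
    ∃ (g : Plane → Plane) (ℓ : Finset Plane → Plane →ᵃ[ℝ] Plane) (C : NNReal),
      LipschitzWith C g ∧ HasCompactSupport g ∧ tsupport g ⊆ Ω ∧
      ∀ K ∈ 𝒯.cells, EqOn g (ℓ K) (triangle K) ∧ ∀ v ∈ K, ℓ K v = f v := by
  classical
  have hex : ∀ K : Finset Plane, ∃ ℓ : Plane →ᵃ[ℝ] Plane, K ∈ 𝒯.cells → ∀ v ∈ K, ℓ v = f v := by
    intro K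
    by_cases hK : K ∈ 𝒯.cells
    · obtain ⟨ℓ, hℓ⟩ := exists_affine_interpolant (𝒯.indep hK.1) hK.2 f
      exact ⟨ℓ, fun _ => hℓ⟩
    · exact ⟨0, fun h => absurd h hK⟩
  choose ℓ hℓ using hex
  have hcompat : ∀ K ∈ 𝒯.cells, ∀ K' ∈ 𝒯.cells, ∀ x ∈ triangle K, x ∈ triangle K' →
      ℓ K x = ℓ K' x := by
    intro K hK K' hK' x hx hx'
    have h1 := 𝒯.inter_subset_convexHull hK.1 hK'.1 ⟨hx, hx'⟩
    have h2 : EqOn (ℓ K) (ℓ K') (K ∩ K' : Set Plane) := fun v hv => by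
      rw [hℓ K hK v hv.1, hℓ K' hK' v hv.2]
    exact AffineMap.eqOn_affineSpan h2 (convexHull_subset_affineSpan _ h1)
  -- on a triangle with no vertex in the support the interpolant vanishes
  have hzero : ∀ K ∈ 𝒯.cells, ∀ x ∈ triangle K, x ∉ Metric.cthickening δ (tsupport f) →
      ℓ K x = 0 := by
    intro K hK x hx hxδ
    have h1 : EqOn (ℓ K) (AffineMap.const ℝ Plane (0 : Plane)) (K : Set Plane) := fun v hv => by
      rw [hℓ K hK v hv]
      refine image_eq_zero_of_notMem_tsupport fun hvs => hxδ ?_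
      exact Metric.mem_cthickening_of_dist_le x v δ _ hvs
        ((dist_le_diam_triangle hx (mem_triangle_of_mem hv)).trans (hdiam K hK))
    exact AffineMap.eqOn_affineSpan h1 (convexHull_subset_affineSpan _ hx)
  set g : Plane → Plane := fun x =>
    if h : ∃ K ∈ 𝒯.cells, x ∈ triangle K then ℓ h.choose x else 0
  have hgℓ : ∀ K ∈ 𝒯.cells, EqOn g (ℓ K) (triangle K) := by
    intro K hK x hx
    have h : ∃ K ∈ 𝒯.cells, x ∈ triangle K := ⟨K, hK, hx⟩
    simp only [g, dif_pos h]
    exact hcompat _ h.choose_spec.1 K hK x h.choose_spec.2 hx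
  have hg0 : ∀ x ∉ Metric.cthickening δ (tsupport f), g x = 0 := by
    intro x hx
    by_cases h : ∃ K ∈ 𝒯.cells, x ∈ triangle K
    · obtain ⟨K, hK, hxK⟩ := h
      rw [hgℓ K hK hxK, hzero K hK x hxK hx]
    · simp only [g, dif_neg h]
  have hsupp : tsupport g ⊆ Metric.cthickening δ (tsupport f) :=
    closure_minimal (fun x hx => by_contra fun h => hx (hg0 x h)) Metric.isClosed_cthickening
  set s := 𝒯.finite_cells.toFinset
  set C : NNReal := s.sup fun K => ‖affineDeriv (ℓ K)‖₊
  refine ⟨g, ℓ, C, ?_, hfc.isCompact.cthickening.of_isClosed_subset (isClosed_tsupport _) hsupp,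
    hsupp.trans hδ, fun K hK => ⟨hgℓ K hK, hℓ K hK⟩⟩
  refine lipschitzWith_of_finite_closed_cover (A := fun o : Option (Finset Plane) =>
    o.elim Ωᶜ triangle) (Finset.insertNone s) ?_ ?_ ?_
  · rintro (_ | K) _
    · exact hΩ.isClosed_compl
    · exact (isCompact_triangle K).isClosed
  · rintro (_ | K) hK
    · refine LipschitzOnWith.of_dist_le_mul fun x hx y hy => ?_
      rw [hg0 x fun h => hx (hδ h), hg0 y fun h => hy (hδ h), dist_self]
      positivity
    · have hKs : K ∈ s := Finset.some_mem_insertNone.1 hK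
      have hK' : K ∈ 𝒯.cells := 𝒯.finite_cells.mem_toFinset.1 hKs
      have h1 : LipschitzWith C (ℓ K) := (lipschitzWith_affine (ℓ K)).weaken
        (Finset.le_sup (f := fun K => ‖affineDeriv (ℓ K)‖₊) hKs)
      refine LipschitzOnWith.of_dist_le_mul fun x hx y hy => ?_
      rw [hgℓ K hK' hx, hgℓ K hK' hy]
      exact h1.dist_le_mul x y
  · intro x
    by_cases hx : x ∈ Ω
    · obtain ⟨K, hK, hxK⟩ := 𝒯.exists_cell_of_mem_closure (subset_closure hx)
      exact ⟨some K, Finset.some_mem_insertNone.2 (𝒯.finite_cells.mem_toFinset.2 hK), hxK⟩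
    · exact ⟨none, Finset.none_mem_insertNone, hx⟩

end Triangulation

/-! ### Density of the finite element spaces -/

/-- Finite combinations of test pairs are test pairs. -/
lemma isTestPair_of_mem_span {Ω : Set Plane} {z : L2Pair Ω}
    (hz : z ∈ Submodule.span ℝ {z | IsTestPair Ω z}) : IsTestPair Ω z := by
  induction hz using Submodule.span_induction with
  | mem z hz => exact hz
  | zero =>
    refine ⟨0, contDiff_const, HasCompactSupport.zero, by simp, Lp.coeFn_zero _ _ _, fun i j => ?_⟩
    filter_upwards [Lp.coeFn_zero Mat 2 (vol Ω)] with x hx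
    change (0 : Lp Mat 2 (vol Ω)) x (i, j) = _
    rw [hx]
    simp
  | add z w _ _ hz hw =>
    obtain ⟨φ, hφ, hφc, hφΩ, hz1, hz2⟩ := hz
    obtain ⟨ψ, hψ, hψc, hψΩ, hw1, hw2⟩ := hw
    refine ⟨φ + ψ, hφ.add hψ, hφc.add hψc,
      (tsupport_add φ ψ).trans (union_subset hφΩ hψΩ), ?_, fun i j => ?_⟩
    · filter_upwards [Lp.coeFn_add z.fst w.fst, hz1, hw1] with x hx h1 h2
      change (z.fst + w.fst : Lp Plane 2 (vol Ω)) x = _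
      rw [hx, Pi.add_apply, h1, h2, Pi.add_apply]
    · filter_upwards [Lp.coeFn_add z.snd w.snd, hz2 i j, hw2 i j] with x hx h1 h2
      change (z.snd + w.snd : Lp Mat 2 (vol Ω)) x (i, j) = _
      rw [hx, fderiv_add (hφ.differentiable (by simp) x) (hψ.differentiable (by simp) x)]
      simp [h1, h2]
  | smul c z _ hz =>
    obtain ⟨φ, hφ, hφc, hφΩ, hz1, hz2⟩ := hz
    refine ⟨c • φ, hφ.const_smul c, hφc.smul_left,
      (closure_mono (Function.support_const_smul_subset c φ)).trans hφΩ, ?_, fun i j => ?_⟩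
    · filter_upwards [Lp.coeFn_smul c z.fst, hz1] with x hx h1
      change (c • z.fst : Lp Plane 2 (vol Ω)) x = _
      rw [hx, Pi.smul_apply, h1, Pi.smul_apply]
    · filter_upwards [Lp.coeFn_smul c z.snd, hz2 i j] with x hx h1
      change (c • z.snd : Lp Mat 2 (vol Ω)) x (i, j) = _
      rw [hx, fderiv_const_smul (hφ.differentiable (by simp) x)]
      simp [h1]

/-- Along a shape regular family whose mesh size tends to zero, every test field is the limit of
its nodal interpolants in the `H¹` norm. -/
lemma IsTestPair.eventually_exists_velocityFE {Ω : Set Plane} (hΩ : IsOpen Ω) {ι : Type*}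
    {l : Filter ι} (𝒯 : ι → Triangulation Ω) {σ : ℝ} (hσ : ∀ i, (𝒯 i).ShapeRegular σ)
    (hh : Tendsto (fun i => (𝒯 i).meshSize) l (𝓝 0)) {s : ℕ} (hs : 1 ≤ s) {z : L2Pair Ω}
    (hz : IsTestPair Ω z) {ε : ℝ} (hε : 0 < ε) :
    ∀ᶠ i in l, ∃ w ∈ (𝒯 i).velocityFE s, ‖z - (w : L2Pair Ω)‖ < ε := by
  rcases isEmpty_or_nonempty ι with hι | ⟨⟨i₀⟩⟩
  · exact Eventually.of_forall fun i => hι.elim i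
  have hfin := (𝒯 i₀).volume_ne_top
  have : IsFiniteMeasure (vol Ω) := ⟨by simpa using hfin.lt_top⟩
  obtain ⟨φ, hφ, hφc, hφΩ, hz1, hz2⟩ := hz
  obtain ⟨M, hM⟩ := ContDiff.lipschitzWith_of_hasCompactSupport (𝕂 := ℝ) (hφc.fderiv (𝕜 := ℝ))
    (hφ.fderiv_right (m := ∞) (by simp)) (by simp)
  obtain ⟨δ, hδ, hδΩ⟩ := hφc.isCompact.exists_cthickening_subset_open hΩ hφΩ
  set d : ι → ℝ := fun i => |σ| * |(𝒯 i).meshSize|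
  have hd : Tendsto d l (𝓝 0) := by simpa [d] using hh.abs.const_mul |σ|
  have hd0 : ∀ i, 0 ≤ d i := fun i => by positivity
  set V : ℝ := measureUnivNNReal (vol Ω) ^ (2 : ENNReal).toReal⁻¹
  -- the bounds for the errors of the field and of the gradient
  set c₁ : ι → ℝ := fun i => 2 * M * d i ^ 2
  set c₂ : ι → ℝ := fun i => ‖gradL‖ * ((2 * (2 * |σ|) + 1) * M * d i)
  have hc : Tendsto (fun i => V * c₁ i + V * c₂ i) l (𝓝 0) := by
    have h1 := (((hd.pow 2).const_mul (2 * (M : ℝ))).const_mul V).add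
      (((hd.const_mul ((2 * (2 * |σ|) + 1) * (M : ℝ))).const_mul ‖gradL‖).const_mul V)
    simpa using h1
  filter_upwards [hc.eventually_lt_const hε, hd.eventually_lt_const hδ] with i hi hiδ
  have hdiam : ∀ K ∈ (𝒯 i).cells, Metric.diam (triangle K) ≤ d i := fun K hK => (hσ i).diam_le hK
  obtain ⟨g, ℓ, C, hgL, hgc, hgΩ, hgℓ⟩ := (𝒯 i).exists_nodal_interpolant hΩ hφc hδΩ
    fun K hK => (hdiam K hK).trans hiδ.le
  have herr : ∀ K ∈ (𝒯 i).cells, ∀ x ∈ triangle K,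
      ‖ℓ K x - φ x‖ ≤ c₁ i ∧ ‖gradL (affineDeriv (ℓ K) - fderiv ℝ φ x)‖ ≤ c₂ i := by
    intro K hK x hx
    obtain ⟨c, ρ, hρ, hball, hκ⟩ := (hσ i).exists_closedBall_subset hK
    have hκ' : Metric.diam (triangle K) ≤ 2 * |σ| * ρ := hκ.trans (by
      have := le_abs_self σ
      gcongr)
    obtain ⟨h1, h2⟩ := interpolation_error (hφ.differentiable (by simp)) hM (hgℓ K hK).2 hρ hball
      hκ' hx
    have h3 := hdiam K hK
    have h4 : 0 ≤ Metric.diam (triangle K) := Metric.diam_nonneg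
    refine ⟨h1.trans ?_, (gradL.le_opNorm _).trans ?_⟩
    · simp only [c₁]
      gcongr
    · refine mul_le_mul_of_nonneg_left (h2.trans ?_) (norm_nonneg _)
      gcongr
  obtain ⟨w, hw1, hw2⟩ := exists_velocity_of_lipschitz hΩ hfin hgL hgc hgΩ
  refine ⟨w, fun k => ⟨fun x => g x k, (𝒯 i).isPiecewisePoly_of_affine hgL.continuous
    (fun K hK => (hgℓ K hK).1) hs k, ?_⟩, ?_⟩
  · filter_upwards [hw1] with x hx
    rw [hx]
  have hfst : ‖z.fst - (w : L2Pair Ω).fst‖ ≤ V * c₁ i := by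
    refine Lp.norm_le_of_ae_bound (by positivity) ?_
    filter_upwards [Lp.coeFn_sub z.fst (w : L2Pair Ω).fst, hz1, hw1,
      (𝒯 i).ae_mem_interior hΩ] with x hx h1 h2 ⟨K, hK, hxK⟩
    have h2' : (w : L2Pair Ω).fst x = g x := h2
    have hxK' := interior_subset hxK
    rw [hx, Pi.sub_apply, h1, h2', (hgℓ K hK).1 hxK', norm_sub_rev]
    exact (herr K hK x hxK').1
  have hsnd : ‖z.snd - (w : L2Pair Ω).snd‖ ≤ V * c₂ i := by
    refine Lp.norm_le_of_ae_bound (by positivity) ?_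
    filter_upwards [Lp.coeFn_sub z.snd (w : L2Pair Ω).snd,
      ae_all_iff.2 fun i => ae_all_iff.2 (hz2 i), hw2,
      (𝒯 i).ae_mem_interior hΩ] with x hx h1 h2 ⟨K, hK, hxK⟩
    have h2' : (w : L2Pair Ω).snd x = gradL (fderiv ℝ g x) := h2
    have h1' : z.snd x = gradL (fderiv ℝ φ x) := by
      ext ⟨a, b⟩
      rw [h1 a b, gradL_apply]
    have hder : fderiv ℝ g x = affineDeriv (ℓ K) := by
      refine ((hasFDerivAt_affine (ℓ K) x).congr_of_eventuallyEq ?_).fderiv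
      filter_upwards [mem_interior_iff_mem_nhds.1 hxK] with y hy using (hgℓ K hK).1 hy
    rw [hx, Pi.sub_apply, h1', h2', hder, norm_sub_rev, ← map_sub]
    exact (herr K hK x (interior_subset hxK)).2
  refine lt_of_le_of_lt ?_ hi
  have h1 : ‖z - (w : L2Pair Ω)‖ ≤ ‖z.fst - (w : L2Pair Ω).fst‖ + ‖z.snd - (w : L2Pair Ω).snd‖ := by
    rw [← sq_le_sq₀ (norm_nonneg _) (by positivity), WithLp.prod_norm_sq_eq_of_L2]
    have h2 := mul_nonneg (norm_nonneg (z.fst - (w : L2Pair Ω).fst))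
      (norm_nonneg (z.snd - (w : L2Pair Ω).snd))
    rw [WithLp.sub_fst, WithLp.sub_snd]
    nlinarith
  exact h1.trans (add_le_add hfst hsnd)

/-- The finite element spaces of a shape regular family whose mesh size tends to zero are
asymptotically dense in `H¹₀(Ω)²`. -/
theorem eventually_exists_velocityFE {Ω : Set Plane} (hΩ : IsOpen Ω) {ι : Type*}
    {l : Filter ι} (𝒯 : ι → Triangulation Ω) {σ : ℝ} (hσ : ∀ i, (𝒯 i).ShapeRegular σ)
    (hh : Tendsto (fun i => (𝒯 i).meshSize) l (𝓝 0)) {s : ℕ} (hs : 1 ≤ s) (v : Velocity Ω)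
    {ε : ℝ} (hε : 0 < ε) : ∀ᶠ i in l, ∃ w ∈ (𝒯 i).velocityFE s, ‖v - w‖ < ε := by
  obtain ⟨z, hz, hvz⟩ := Metric.mem_closure_iff.1 v.2 (ε / 2) (half_pos hε)
  rw [dist_eq_norm] at hvz
  filter_upwards [(isTestPair_of_mem_span hz).eventually_exists_velocityFE hΩ 𝒯 hσ hh hs
    (half_pos hε)] with i ⟨w, hw, hzw⟩
  refine ⟨w, hw, ?_⟩
  have h1 : ‖v - w‖ = ‖((v : L2Pair Ω) - z) + (z - (w : L2Pair Ω))‖ := by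
    rw [sub_add_sub_cancel]
    rfl
  rw [h1]
  linarith [norm_add_le ((v : L2Pair Ω) - z) (z - (w : L2Pair Ω))]

end TSEFEM

theorem mainTheorem1
    {Ω : Set TSEFEM.Plane} (hΩ : IsOpen Ω)
    {Re T : ℝ} (hRe : 0 < Re) (hT : 0 < T)
    -- an exact weak solution of the unsteady Stokes problem
    {u : ℝ → TSEFEM.Velocity Ω} {p : ℝ → TSEFEM.Pressure Ω}
    (hu : TSEFEM.IsStokesSolution Re T u p)
    -- a shape-regular family of triangulations whose mesh size tends to zero along `l`
    {ι : Type*} {l : Filter ι} (𝒯 : ι → TSEFEM.Triangulation Ω)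
    {σ : ℝ} (hσ : ∀ i, (𝒯 i).ShapeRegular σ)
    (hh : Filter.Tendsto (fun i => (𝒯 i).meshSize) l (nhds 0))
    -- velocity degree greater than pressure degree
    {s r : ℕ} (hrs : r < s)
    -- the discrete modes, started from a (quasi-)best approximation of the initial velocity
    {uh : ι → ℕ → TSEFEM.Velocity Ω} {ph : ι → ℕ → TSEFEM.Pressure Ω}
    (hmodes : ∀ i, TSEFEM.IsDiscreteModes (𝒯 i) s r Re (uh i) (ph i))
    {C : ℝ} (hproj : ∀ i, ∀ w ∈ (𝒯 i).velocityFE s, ‖u 0 - uh i 0‖ ≤ C * ‖u 0 - w‖)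
    (m : ℕ) :
    ∃ e₀ : ι → ℝ,
      (∀ i, Filter.Tendsto (fun dt => TSEFEM.truncationError u (uh i) m dt)
        (nhdsWithin 0 (Set.Ioi 0)) (nhds (e₀ i))) ∧
      Filter.Tendsto e₀ l (nhds 0) := by
  refine ⟨fun i => ‖u 0 - uh i 0‖, fun i => ?_, ?_⟩
  · have h1 : Tendsto (fun dt : ℝ => ∑ k ∈ Finset.range (m + 1), dt ^ k • uh i k) (𝓝[>] 0)
        (𝓝 (uh i 0)) := by
      have h2 : Continuous fun dt : ℝ => ∑ k ∈ Finset.range (m + 1), dt ^ k • uh i k := by fun_prop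
      have h3 := h2.tendsto 0
      -- at `dt = 0` only the mode `k = 0` survives
      simp only [Finset.sum_range_succ', pow_succ, mul_zero, zero_smul, Finset.sum_const_zero,
        pow_zero, one_smul, zero_add] at h3
      simp only [Finset.sum_range_succ', pow_succ, pow_zero, one_smul]
      exact h3.mono_left nhdsWithin_le_nhds
    exact ((hu.tendsto_initial hΩ hRe hT).sub h1).norm
  · rw [Metric.tendsto_nhds]
    intro ε hε
    filter_upwards [TSEFEM.eventually_exists_velocityFE hΩ 𝒯 hσ hh (Nat.one_le_of_lt hrs) (u 0)
      (show 0 < ε / (|C| + 1) by positivity)] with i ⟨w, hw, hlt⟩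
    rw [dist_zero_right, norm_norm]
    rw [lt_div_iff₀ (by positivity)] at hlt
    have h1 := hproj i w hw
    have h2 : C * ‖u 0 - w‖ ≤ |C| * ‖u 0 - w‖ :=
      mul_le_mul_of_nonneg_right (le_abs_self C) (norm_nonneg _)
    nlinarith [norm_nonneg (u 0 - w)]
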